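/- For a complex Hilbert space $H$ and $1<p<\infty$, let $C_p(H)$ be the $p$-Schatten von Neumann class, that is, the space of compact operators $a$ on $H$ with $\|a\|_p=\big(\sum_n \sigma_n(a)^p\big)^{1/p}<\infty$, where the $\sigma_n(a)$ are the singular values of $a$ (the eigenvalues of $|a|=(a^*a)^{1/2}$ repeated according to multiplicity), and let $S(C_p(H))=\{a\in C_p(H):\|a\|_p=1\}$ be its unit sphere. A minimal partial isometry is a rank-one operator $e$ on $H$ with $ee^*e=e$; let $\mathcal{U}_{\min}(H)$ be the set of all of them (they belong to $S(C_p(H))$). For $\eta,\xi\in H$ let $\eta\otimes\xi$ be the operator $\zeta\mapsto\langle\zeta|\xi\rangle\,\eta$, where the inner product is linear in its first argument. Let $\mathbb{T}=\{\lambda\in\mathbb{C}:|\lambda|=1\}$. Proposition. Let $H$ and $H'$ be complex Hilbert spaces, let $1<p<\infty$ with $p\neq 2$, and let $\Delta:S(C_p(H))\to S(C_p(H'))$ be a surjective isometry, that is, a surjective map with $\|\Delta(a)-\Delta(b)\|_p=\|a-b\|_p$ for all $a,b\in S(C_p(H))$. Then the following statements hold. (a) $\Delta$ maps minimal partial isometries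 to minimal partial isometries, and $\Delta(\mathcal{U}_{\min}(H))=\mathcal{U}_{\min}(H')$. (b) For each $e_0\in\mathcal{U}_{\min}(H)$, $\Delta(\lambda e_0)=\lambda\Delta(e_0)$ for all $\lambda\in\mathbb{T}$, or $\Delta(\lambda e_0)=\overline{\lambda}\Delta(e_0)$ for all $\lambda\in\mathbb{T}$. (c) For each $e_0\in\mathcal{U}_{\min}(H)$, if $\Delta(\mu e_0)=\mu\Delta(e_0)$ (respectively, $\Delta(\mu e_0)=\overline{\mu}\Delta(e_0)$) for some $\mu\in\mathbb{T}\setminus\{1,-1\}$, then $\Delta(\lambda e_0)=\lambda\Delta(e_0)$ (respectively, $\Delta(\lambda e_0)=\overline{\lambda}\Delta(e_0)$) for every $\lambda\in\mathbb{T}$. (d) Let $\{\eta_j\}_{j\in J}$ and $\{\xi_j\}_{j\in J}$ be orthonormal bases of $H$. Then there exist orthonormal bases $\{\widetilde\eta_j\}_{j\in J}$ and $\{\widetilde\xi_j\}_{j\in J}$ of $H'$ such that $\Delta(\eta_j\otimes\xi_j)=\widetilde\eta_j\otimes\widetilde\xi_j$ for all $j\in J$. -/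

import Mathlib

open scoped NNReal ENNReal

noncomputable section

namespace Schatten

variable {H : Type*} [NormedAddCommGroup H] [InnerProductSpace ℂ H] [CompleteSpace H]

/-- The multiplicity of `μ` as a singular value of `a`: the dimension of the eigenspace of
`|a| = (a* a)^{1/2}` for the eigenvalue `μ` (finite for compact `a` and `μ > 0`). -/
def singularMultiplicity (a : H →L[ℂ] H) (μ : ℝ≥0) : ℕ :=
  Module.finrank ℂ
    (Module.End.eigenspace ((CFC.abs a : H →L[ℂ] H) : H →ₗ[ℂ] H) ((μ : ℝ) : ℂ))

/-- The `p`-Schatten norm `‖a‖_p = (∑ₙ σₙ(a)^p)^{1/p}` of a compact operator `a`, where the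
singular values `σₙ(a)` are repeated according to multiplicity. It takes values in `[0, ∞]`,
and is `∞` for the compact operators that do not belong to `C_p(H)`. -/
def schattenNorm (p : ℝ) (a : H →L[ℂ] H) : ℝ≥0∞ :=
  (∑' μ : ℝ≥0, (singularMultiplicity a μ : ℝ≥0∞) * (μ : ℝ≥0∞) ^ p) ^ (1 / p)

/-- The `p`-Schatten von Neumann class `C_p(H)`. -/
def schattenClass (p : ℝ) (H : Type*) [NormedAddCommGroup H] [InnerProductSpace ℂ H]
    [CompleteSpace H] : Set (H →L[ℂ] H) :=
  {a | IsCompactOperator a ∧ schattenNorm p a < ∞}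

/-- The unit sphere `S(C_p(H))`. -/
def schattenSphere (p : ℝ) (H : Type*) [NormedAddCommGroup H] [InnerProductSpace ℂ H]
    [CompleteSpace H] : Set (H →L[ℂ] H) :=
  {a | a ∈ schattenClass p H ∧ schattenNorm p a = 1}

/-- The set `U_min(H)` of minimal (that is, rank-one) partial isometries on `H`. -/
def minimalPartialIsometries (H : Type*) [NormedAddCommGroup H] [InnerProductSpace ℂ H]
    [CompleteSpace H] : Set (H →L[ℂ] H) :=
  {e | e * star e * e = e ∧ Module.finrank ℂ (LinearMap.range (e : H →ₗ[ℂ] H)) = 1}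

/-- `Δ` restricts to a surjective isometry from `S(C_p(H))` onto `S(C_p(H'))`, both with the
distance `‖a - b‖_p`. The values of `Δ` outside `S(C_p(H))` play no role. -/
structure IsSurjectiveSphereIsometry (p : ℝ) {H H' : Type*}
    [NormedAddCommGroup H] [InnerProductSpace ℂ H] [CompleteSpace H]
    [NormedAddCommGroup H'] [InnerProductSpace ℂ H'] [CompleteSpace H']
    (Δ : (H →L[ℂ] H) → (H' →L[ℂ] H')) : Prop where
  mapsTo : Set.MapsTo Δ (schattenSphere p H) (schattenSphere p H')
  surjOn : Set.SurjOn Δ (schattenSphere p H) (schattenSphere p H')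
  norm_sub : ∀ a ∈ schattenSphere p H, ∀ b ∈ schattenSphere p H,
    schattenNorm p (Δ a - Δ b) = schattenNorm p (a - b)

end Schatten

end

open scoped NNReal ENNReal

noncomputable section

namespace Schatten

universe u v

/-- `x ≤ y` for exponents `q > 1`, and `y ≤ x` for exponents `q < 1`. -/
def PowLE (q : ℝ) (x y : ℝ≥0∞) : Prop := (1 < q → x ≤ y) ∧ (q < 1 → y ≤ x)

namespace PowLE

variable {q : ℝ} {x y z x' y' : ℝ≥0∞}

theorem refl (q : ℝ) (x : ℝ≥0∞) : PowLE q x x := ⟨fun _ => le_rfl, fun _ => le_rfl⟩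

theorem of_eq (h : x = y) : PowLE q x y := h ▸ refl q x

theorem trans (h : PowLE q x y) (h' : PowLE q y z) : PowLE q x z :=
  ⟨fun hq => (h.1 hq).trans (h'.1 hq), fun hq => (h'.2 hq).trans (h.2 hq)⟩

theorem antisymm (hq : q ≠ 1) (h : PowLE q x y) (h' : PowLE q y x) : x = y := by
  rcases lt_or_gt_of_ne hq with hq | hq
  · exact le_antisymm (h'.2 hq) (h.2 hq)
  · exact le_antisymm (h.1 hq) (h'.1 hq)

theorem add (h : PowLE q x y) (h' : PowLE q x' y') : PowLE q (x + x') (y + y') :=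
  ⟨fun hq => add_le_add (h.1 hq) (h'.1 hq), fun hq => add_le_add (h.2 hq) (h'.2 hq)⟩

theorem mul_left (c : ℝ≥0∞) (h : PowLE q x y) : PowLE q (c * x) (c * y) :=
  ⟨fun hq => mul_le_mul_right (h.1 hq) c, fun hq => mul_le_mul_right (h.2 hq) c⟩

theorem tsum {ι : Type*} {f g : ι → ℝ≥0∞} (h : ∀ i, PowLE q (f i) (g i)) :
    PowLE q (∑' i, f i) (∑' i, g i) :=
  ⟨fun hq => ENNReal.tsum_le_tsum fun i => (h i).1 hq,
    fun hq => ENNReal.tsum_le_tsum fun i => (h i).2 hq⟩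

theorem eq_of_add_eq (hq : q ≠ 1) (h : PowLE q x y) (h' : PowLE q x' y')
    (hs : x + x' = y + y') (hfin : x + x' ≠ ∞) : x = y ∧ x' = y' := by
  have hfin' := hs ▸ hfin
  rw [ENNReal.add_ne_top] at hfin hfin'
  have key : ∀ {a b c d : ℝ≥0∞}, a ≤ b → c ≤ d → a + c = b + d → a ≠ ∞ → c ≠ ∞ →
      a = b ∧ c = d := by
    intro a b c d h1 h2 h3 ha hc
    refine ⟨le_antisymm h1 ?_, le_antisymm h2 ?_⟩
    · by_contra! hlt
      exact absurd h3 (ENNReal.add_lt_add_of_lt_of_le hc hlt h2).ne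
    · by_contra! hlt
      exact absurd h3 (ENNReal.add_lt_add_of_le_of_lt ha h1 hlt).ne
  rcases lt_or_gt_of_ne hq with hq | hq
  · have := key (h.2 hq) (h'.2 hq) hs.symm hfin'.1 hfin'.2
    exact ⟨this.1.symm, this.2.symm⟩
  · exact key (h.1 hq) (h'.1 hq) hs hfin.1 hfin.2

end PowLE

theorem eq_of_tsum_eq_of_le {ι : Type*} {f g : ι → ℝ≥0∞} (h : ∀ i, f i ≤ g i)
    (hs : ∑' i, f i = ∑' i, g i) (hfin : ∑' i, f i ≠ ∞) (i : ι) : f i = g i := by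
  by_contra hne
  exact absurd hs (ENNReal.tsum_lt_tsum hfin h (lt_of_le_of_ne (h i) hne)).ne

theorem PowLE.eq_of_tsum_eq {q : ℝ} (hq : q ≠ 1) {ι : Type*} {f g : ι → ℝ≥0∞}
    (h : ∀ i, PowLE q (f i) (g i)) (hs : ∑' i, f i = ∑' i, g i) (hfin : ∑' i, f i ≠ ∞)
    (i : ι) : f i = g i := by
  rcases lt_or_gt_of_ne hq with hq | hq
  · exact (eq_of_tsum_eq_of_le (fun i => (h i).2 hq) hs.symm (hs ▸ hfin) i).symm
  · exact eq_of_tsum_eq_of_le (fun i => (h i).1 hq) hs hfin i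

theorem rpow_sub_tangent_pos {q x : ℝ} (hq : 1 < q) (hx : 0 ≤ x) (hx1 : x ≠ 1) :
    0 < x ^ q - 1 - q * (x - 1) := by
  have := one_add_mul_self_lt_rpow_one_add (s := x - 1) (by linarith)
    (sub_ne_zero.2 hx1) hq
  rw [add_sub_cancel] at this
  linarith

theorem jensen_real {ι : Type*} {q : ℝ} (hq : 1 < q) {w t : ι → ℝ} (hw : ∀ i, 0 ≤ w i)
    (ht : ∀ i, 0 ≤ t i) (hsw : Summable w) (hw1 : ∑' i, w i ≤ 1)
    (hst : Summable fun i => w i * t i) (hstq : Summable fun i => w i * t i ^ q) :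
    (∑' i, w i * t i) ^ q ≤ ∑' i, w i * t i ^ q ∧
      ((∑' i, w i * t i) ^ q = ∑' i, w i * t i ^ q →
        ∀ i, w i ≠ 0 → t i = ∑' i, w i * t i) := by
  set m := ∑' i, w i * t i with hm
  have hm0 : 0 ≤ m := tsum_nonneg fun i => mul_nonneg (hw i) (ht i)
  rcases hm0.eq_or_lt with h0 | hpos
  · rw [← h0]
    refine ⟨?_, ?_⟩
    · rw [Real.zero_rpow (by linarith)]
      exact tsum_nonneg fun i => mul_nonneg (hw i) (Real.rpow_nonneg (ht i) q)
    · intro _ i hi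
      have := (hasSum_zero_iff_of_nonneg fun i => mul_nonneg (hw i) (ht i)).1
        (by simpa [← hm, ← h0] using hst.hasSum)
      have := congrFun this i
      simpa [hi] using this
  · have hgap : ∀ i, 0 ≤ w i * ((t i / m) ^ q - 1 - q * (t i / m - 1)) := by
      intro i
      refine mul_nonneg (hw i) ?_
      by_cases h1 : t i / m = 1
      · simp [h1]
      · exact (rpow_sub_tangent_pos hq (div_nonneg (ht i) hm0) h1).le
    have hmq : 0 < m ^ q := Real.rpow_pos_of_pos hpos q
    set W := ∑' i, w i with hW
    set T := ∑' i, w i * t i ^ q with hT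
    have hsum : HasSum (fun i => w i * ((t i / m) ^ q - 1 - q * (t i / m - 1)))
        (T / m ^ q - W - q * (m / m - W)) := by
      have h1 := (((hstq.hasSum.div_const (m ^ q)).sub hsw.hasSum).sub
        (((hst.hasSum.div_const m).sub hsw.hasSum).mul_left q))
      have e : (fun i => w i * ((t i / m) ^ q - 1 - q * (t i / m - 1))) = fun i =>
          w i * t i ^ q / m ^ q - w i - q * (w i * t i / m - w i) := by
        funext i
        rw [Real.div_rpow (ht i) hm0]
        ring
      rw [e]
      exact h1
    rw [div_self hpos.ne'] at hsum
    have hge := hsum.nonneg hgap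
    have hTm : 1 ≤ T / m ^ q := by nlinarith
    refine ⟨(one_le_div hmq).1 hTm, fun heq i hi => ?_⟩
    rw [← heq, div_self hmq.ne'] at hsum hge
    have hz : (1 : ℝ) - W - q * (1 - W) = 0 := by nlinarith
    rw [hz] at hsum
    have := congrFun ((hasSum_zero_iff_of_nonneg hgap).1 hsum) i
    simp only [Pi.zero_apply, mul_eq_zero, hi, false_or] at this
    by_contra hne
    have h1 : t i / m ≠ 1 := fun h => hne ((div_eq_one_iff_eq hpos.ne').1 h)
    exact absurd this (rpow_sub_tangent_pos hq (div_nonneg (ht i) hm0) h1).ne'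

theorem tsum_coe_mul_ne_top {ι : Type*} {q : ℝ} (hq : 1 ≤ q) {w t : ι → ℝ≥0}
    (hw : ∑' i, (w i : ℝ≥0∞) ≤ 1) (hfin : ∑' i, (w i : ℝ≥0∞) * (t i : ℝ≥0∞) ^ q ≠ ∞) :
    ∑' i, (w i : ℝ≥0∞) * (t i : ℝ≥0∞) ≠ ∞ := by
  have : ∑' i, (w i : ℝ≥0∞) * (t i : ℝ≥0∞) ≤
      ∑' i, ((w i : ℝ≥0∞) + (w i : ℝ≥0∞) * (t i : ℝ≥0∞) ^ q) := by
    refine ENNReal.tsum_le_tsum fun i => ?_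
    rcases le_total (t i : ℝ≥0∞) 1 with h | h
    · exact le_add_right (mul_le_of_le_one_right' h)
    · refine le_add_left (mul_le_mul_right ?_ _)
      simpa using ENNReal.rpow_le_rpow_of_exponent_le h hq
  refine ne_top_of_le_ne_top ?_ this
  rw [ENNReal.tsum_add]
  exact ENNReal.add_ne_top.2 ⟨ne_top_of_le_ne_top ENNReal.one_ne_top hw, hfin⟩

theorem jensen_of_one_lt {ι : Type*} {q : ℝ} (hq : 1 < q) {w t : ι → ℝ≥0}
    (hw : ∑' i, (w i : ℝ≥0∞) ≤ 1) (hfin : ∑' i, (w i : ℝ≥0∞) * (t i : ℝ≥0∞) ^ q ≠ ∞) :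
    (∑' i, (w i : ℝ≥0∞) * t i) ^ q ≤ ∑' i, (w i : ℝ≥0∞) * (t i : ℝ≥0∞) ^ q ∧
      ((∑' i, (w i : ℝ≥0∞) * t i) ^ q = ∑' i, (w i : ℝ≥0∞) * (t i : ℝ≥0∞) ^ q →
        ∀ i, w i ≠ 0 → (t i : ℝ≥0∞) = ∑' i, (w i : ℝ≥0∞) * t i) := by
  have hq0 : 0 ≤ q := by linarith
  have hfin' := tsum_coe_mul_ne_top hq.le hw hfin
  have hwfin := ne_top_of_le_ne_top ENNReal.one_ne_top hw
  simp only [← ENNReal.coe_rpow_of_nonneg _ hq0, ← ENNReal.coe_mul] at hfin hfin' ⊢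
  have h1 := ENNReal.tsum_coe_ne_top_iff_summable.1 hfin
  have h2 := ENNReal.tsum_coe_ne_top_iff_summable.1 hfin'
  have h3 := ENNReal.tsum_coe_ne_top_iff_summable.1 hwfin
  rw [← ENNReal.coe_tsum h1, ← ENNReal.coe_tsum h2, ← ENNReal.coe_rpow_of_nonneg _ hq0]
  rw [← ENNReal.coe_tsum h3] at hw
  have key := jensen_real hq (w := fun i => (w i : ℝ)) (t := fun i => (t i : ℝ))
    (fun i => (w i).2) (fun i => (t i).2) (by exact_mod_cast h3) (by exact_mod_cast hw)
    (by exact_mod_cast h2) (by exact_mod_cast h1)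
  exact_mod_cast key

theorem jensen_of_lt_one {ι : Type*} {q : ℝ} (hq0 : 0 < q) (hq : q < 1) {w t : ι → ℝ≥0}
    (hw : ∑' i, (w i : ℝ≥0∞) ≤ 1) (hfin : ∑' i, (w i : ℝ≥0∞) * (t i : ℝ≥0∞) ≠ ∞) :
    ∑' i, (w i : ℝ≥0∞) * (t i : ℝ≥0∞) ^ q ≤ (∑' i, (w i : ℝ≥0∞) * t i) ^ q ∧
      ((∑' i, (w i : ℝ≥0∞) * t i) ^ q = ∑' i, (w i : ℝ≥0∞) * (t i : ℝ≥0∞) ^ q →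
        ∀ i, w i ≠ 0 → (t i : ℝ≥0∞) = ∑' i, (w i : ℝ≥0∞) * t i) := by
  have hqi : 1 < q⁻¹ := (one_lt_inv₀ hq0).2 hq
  have hcan : ∀ x : ℝ≥0∞, (x ^ q) ^ q⁻¹ = x := fun x => ENNReal.rpow_rpow_inv hq0.ne' x
  have hcast : ∀ i, ((t i ^ q : ℝ≥0) : ℝ≥0∞) = (t i : ℝ≥0∞) ^ q :=
    fun i => ENNReal.coe_rpow_of_nonneg _ hq0.le
  have key := jensen_of_one_lt hqi (w := w) (t := fun i => t i ^ q) hw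
    (by simpa only [hcast, hcan] using hfin)
  simp only [hcast, hcan] at key
  refine ⟨?_, fun heq i hi => ?_⟩
  · have := ENNReal.rpow_le_rpow key.1 hq0.le
    rwa [ENNReal.rpow_inv_rpow hq0.ne'] at this
  · have h2 := key.2 (by rw [← heq, hcan]) i hi
    rw [← heq] at h2
    exact (ENNReal.rpow_left_injective hq0.ne') h2

theorem jensen {ι : Type*} {q : ℝ} (hq0 : 0 < q) {w t : ι → ℝ≥0}
    (hw : ∑' i, (w i : ℝ≥0∞) ≤ 1) (hfin : ∑' i, (w i : ℝ≥0∞) * (t i : ℝ≥0∞) ≠ ∞) :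
    PowLE q ((∑' i, (w i : ℝ≥0∞) * t i) ^ q) (∑' i, (w i : ℝ≥0∞) * (t i : ℝ≥0∞) ^ q) := by
  refine ⟨fun hq => ?_, fun hq => (jensen_of_lt_one hq0 hq hw hfin).1⟩
  by_cases h : ∑' i, (w i : ℝ≥0∞) * (t i : ℝ≥0∞) ^ q = ∞
  · rw [h]; exact le_top
  · exact (jensen_of_one_lt hq hw h).1

theorem jensen_eq {ι : Type*} {q : ℝ} (hq0 : 0 < q) (hq1 : q ≠ 1) {w t : ι → ℝ≥0}
    (hw : ∑' i, (w i : ℝ≥0∞) ≤ 1) (hfin : ∑' i, (w i : ℝ≥0∞) * (t i : ℝ≥0∞) ≠ ∞)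
    (heq : (∑' i, (w i : ℝ≥0∞) * t i) ^ q = ∑' i, (w i : ℝ≥0∞) * (t i : ℝ≥0∞) ^ q)
    {i : ι} (hi : w i ≠ 0) : (t i : ℝ≥0∞) = ∑' i, (w i : ℝ≥0∞) * t i := by
  rcases lt_or_gt_of_ne hq1 with hq | hq
  · exact (jensen_of_lt_one hq0 hq hw hfin).2 heq i hi
  · refine (jensen_of_one_lt hq hw ?_).2 heq i hi
    rw [← heq]
    exact ENNReal.rpow_ne_top_of_nonneg hq0.le hfin

theorem powLE_two_mul_add_div_two {q : ℝ} (hq0 : 0 < q) (x y : ℝ≥0) :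
    PowLE q (2 * (((x + y) / 2 : ℝ≥0) : ℝ≥0∞) ^ q) ((x : ℝ≥0∞) ^ q + (y : ℝ≥0∞) ^ q) := by
  have key := (jensen hq0 (w := fun _ : Bool => 1 / 2) (t := fun b => cond b x y)
    (by simp [tsum_fintype]) (by
      simp only [tsum_fintype, Fintype.sum_bool, cond_true, cond_false]
      exact ENNReal.add_ne_top.2 ⟨ENNReal.mul_ne_top ENNReal.coe_ne_top ENNReal.coe_ne_top,
        ENNReal.mul_ne_top ENNReal.coe_ne_top ENNReal.coe_ne_top⟩)).mul_left 2
  simp only [tsum_fintype, Fintype.sum_bool, cond_true, cond_false] at key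
  have e1 : (((1 / 2 : ℝ≥0) : ℝ≥0∞) * x + ((1 / 2 : ℝ≥0) : ℝ≥0∞) * y) =
      (((x + y) / 2 : ℝ≥0) : ℝ≥0∞) := by
    rw [← ENNReal.coe_mul, ← ENNReal.coe_mul, ← ENNReal.coe_add]
    congr 1
    ring
  have e2 : ∀ a b : ℝ≥0∞, 2 * (((1 / 2 : ℝ≥0) : ℝ≥0∞) * a + ((1 / 2 : ℝ≥0) : ℝ≥0∞) * b) =
      a + b := by
    intro a b
    have h : (2 : ℝ≥0∞) * ((1 / 2 : ℝ≥0) : ℝ≥0∞) = 1 := by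
      rw [show (2 : ℝ≥0∞) = ((2 : ℝ≥0) : ℝ≥0∞) from rfl, ← ENNReal.coe_mul]
      simp
    rw [mul_add, ← mul_assoc, ← mul_assoc, h, one_mul, one_mul]
  rwa [e1, e2] at key

theorem powLE_tsum {ι κ : Type*} {q : ℝ} (hq0 : 0 < q) {w : κ → ι → ℝ≥0} {t : ι → ℝ≥0}
    {s : κ → ℝ≥0} (hw : ∀ k, ∑' i, (w k i : ℝ≥0∞) ≤ 1)
    (hs : ∀ k, ∑' i, (w k i : ℝ≥0∞) * t i = s k) :
    PowLE q (∑' k, (s k : ℝ≥0∞) ^ q) (∑' i, (∑' k, (w k i : ℝ≥0∞)) * (t i : ℝ≥0∞) ^ q) := by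
  simp only [← ENNReal.tsum_mul_right]
  rw [ENNReal.tsum_comm]
  refine PowLE.tsum fun k => ?_
  rw [← hs k]
  exact jensen hq0 (hw k) (by simp [hs])

theorem eq_of_powLE_tsum_eq {ι κ : Type*} {q : ℝ} (hq0 : 0 < q) (hq1 : q ≠ 1)
    {w : κ → ι → ℝ≥0} {t : ι → ℝ≥0}
    {s : κ → ℝ≥0} (hw : ∀ k, ∑' i, (w k i : ℝ≥0∞) ≤ 1)
    (hs : ∀ k, ∑' i, (w k i : ℝ≥0∞) * t i = s k)
    (heq : ∑' k, (s k : ℝ≥0∞) ^ q = ∑' i, (∑' k, (w k i : ℝ≥0∞)) * (t i : ℝ≥0∞) ^ q)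
    (hfin : ∑' k, (s k : ℝ≥0∞) ^ q ≠ ∞) {k : κ} {i : ι} (hki : w k i ≠ 0) : t i = s k := by
  simp only [← ENNReal.tsum_mul_right] at heq
  rw [ENNReal.tsum_comm] at heq
  have h : ∀ k, PowLE q ((s k : ℝ≥0∞) ^ q) (∑' i, (w k i : ℝ≥0∞) * (t i : ℝ≥0∞) ^ q) := by
    intro k
    rw [← hs k]
    exact jensen hq0 (hw k) (by simp [hs])
  have h' := PowLE.eq_of_tsum_eq hq1 h heq hfin k
  have := jensen_eq hq0 hq1 (t := t) (hw k) (by simp [hs]) (by rw [hs]; exact h') hki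
  rw [hs] at this
  exact_mod_cast this

section SingularBasis

variable {H : Type u} [NormedAddCommGroup H] [InnerProductSpace ℂ H]
  {K : Type*} [NormedAddCommGroup K] [InnerProductSpace ℂ K]
  {ι κ : Type*}

/-- A Hilbert basis that `c` maps to an orthogonal family. -/
def IsSingularBasis (c : H →L[ℂ] K) (f : HilbertBasis ι ℂ H) : Prop :=
  ∀ i k, i ≠ k → inner ℂ (c (f i)) (c (f k)) = 0

/-- The sum `∑ᵢ (‖c fᵢ‖²)^q`. -/
def powSum (q : ℝ) (c : H →L[ℂ] K) (f : ι → H) : ℝ≥0∞ :=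
  ∑' i, ((‖c (f i)‖₊ ^ 2 : ℝ≥0) : ℝ≥0∞) ^ q

theorem powSum_half (p : ℝ)
    (c : H →L[ℂ] K) (f : ι → H) :
    powSum (p / 2) c f = ∑' i, (‖c (f i)‖₊ : ℝ≥0∞) ^ p := by
  refine tsum_congr fun i => ?_
  rw [ENNReal.coe_pow, ← ENNReal.rpow_natCast, ← ENNReal.rpow_mul]
  congr 1
  push_cast
  ring

theorem hasSum_apply (c : H →L[ℂ] K) (f : HilbertBasis ι ℂ H) (x : H) :
    HasSum (fun i => inner ℂ (f i) x • c (f i)) (c x) := by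
  have := (f.hasSum_repr x).mapL c
  simpa [HilbertBasis.repr_apply_apply] using this

namespace IsSingularBasis

variable {c : H →L[ℂ] K} {f : HilbertBasis ι ℂ H}

theorem inner_apply_apply (hf : IsSingularBasis c f) (i : ι) (x : H) :
    inner ℂ (c (f i)) (c x) = (‖c (f i)‖ ^ 2 : ℝ) * inner ℂ (f i) x := by
  have h1 := (hasSum_apply c f x).mapL (innerSL ℂ (c (f i)))
  have h2 := hasSum_single (f := fun k => innerSL ℂ (c (f i)) (inner ℂ (f k) x • c (f k))) i
    (fun k hk => by simp [hf i k hk.symm])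
  rw [innerSL_apply_apply] at h1
  rw [h1.unique h2]
  simp [inner_self_eq_norm_sq_to_K, mul_comm]

theorem hasSum_norm_sq (hf : IsSingularBasis c f) (x : H) :
    HasSum (fun i => ‖inner ℂ (f i) x‖ ^ 2 * ‖c (f i)‖ ^ 2) (‖c x‖ ^ 2) := by
  have h1 := (hasSum_apply c f x).mapL (innerSL ℂ (c x))
  have h2 := (Complex.hasSum_re h1)
  convert h2 using 1
  · ext i
    rw [innerSL_apply_apply, inner_smul_right, ← inner_conj_symm (c x), hf.inner_apply_apply, map_mul,
      Complex.conj_ofReal, mul_left_comm, Complex.mul_conj, Complex.normSq_eq_norm_sq,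
      ← Complex.ofReal_mul, Complex.ofReal_re, mul_comm]
  · rw [innerSL_apply_apply, inner_self_eq_norm_sq_to_K]
    norm_cast

theorem tsum_nnnorm_sq (hf : IsSingularBasis c f) (x : H) :
    ∑' i, ((‖inner ℂ (f i) x‖₊ ^ 2 : ℝ≥0) : ℝ≥0∞) * ((‖c (f i)‖₊ ^ 2 : ℝ≥0) : ℝ≥0∞) =
      ((‖c x‖₊ ^ 2 : ℝ≥0) : ℝ≥0∞) := by
  simp only [← ENNReal.coe_mul]
  refine (ENNReal.hasSum_coe.2 ?_).tsum_eq
  have := hf.hasSum_norm_sq x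
  exact NNReal.hasSum_coe.1 (by simpa using this)

end IsSingularBasis

theorem tsum_nnnorm_inner_sq (f : HilbertBasis ι ℂ H) (x : H) :
    ∑' i, ((‖inner ℂ (f i) x‖₊ ^ 2 : ℝ≥0) : ℝ≥0∞) = ((‖x‖₊ ^ 2 : ℝ≥0) : ℝ≥0∞) := by
  have h : IsSingularBasis (ContinuousLinearMap.id ℂ H) f := fun i k hik => f.orthonormal.2 hik
  have hn : ∀ i, ‖f i‖₊ = 1 := fun i => NNReal.eq (f.orthonormal.1 i)
  simpa [hn] using h.tsum_nnnorm_sq x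

theorem nnnorm_inner_comm (x y : H) : ‖inner ℂ x y‖₊ = ‖inner ℂ y x‖₊ :=
  NNReal.eq (norm_inner_symm x y)

/-- Bessel's inequality for the nonzero vectors of an orthogonal family, normalized. -/
theorem tsum_inner_div_le {y : ι → K} (hy : ∀ i k, i ≠ k → inner ℂ (y i) (y k) = 0) (x : K) :
    ∑' i, ((‖inner ℂ x (y i)‖₊ ^ 2 / ‖y i‖₊ ^ 2 : ℝ≥0) : ℝ≥0∞) ≤
      ((‖x‖₊ ^ 2 : ℝ≥0) : ℝ≥0∞) := by
  let S := {i // y i ≠ 0}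
  have horth : Orthonormal ℂ fun i : S => ((‖y i‖⁻¹ : ℝ) : ℂ) • y i := by
    refine ⟨fun i => ?_, fun i k hik => ?_⟩
    · simp [norm_smul, i.2]
    · simp [inner_smul_left, inner_smul_right, hy i k (fun h => hik (Subtype.ext h))]
  have hsupp : Function.support
      (fun i => ((‖inner ℂ x (y i)‖₊ ^ 2 / ‖y i‖₊ ^ 2 : ℝ≥0) : ℝ≥0∞)) ⊆ {i | y i ≠ 0} := by
    intro i hi h
    simp [h] at hi
  rw [← tsum_subtype_eq_of_support_subset hsupp]
  rw [ENNReal.tsum_eq_iSup_sum]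
  refine iSup_le fun s => ?_
  have := horth.sum_inner_products_le x (s := s)
  rw [← ENNReal.ofNNReal_finsetSum, ENNReal.coe_le_coe, ← NNReal.coe_le_coe]
  push_cast
  refine le_trans (le_of_eq (Finset.sum_congr rfl fun i _ => ?_)) this
  rw [inner_smul_left, norm_mul, mul_pow, norm_inner_symm]
  simp [div_eq_inv_mul]

theorem powLE_powSum {q : ℝ} (hq0 : 0 < q) {a : H →L[ℂ] K} {v : HilbertBasis ι ℂ H}
    (hv : IsSingularBasis a v) (f : HilbertBasis κ ℂ H) :
    PowLE q (powSum q a f) (powSum q a v) := by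
  have hw : ∀ k, ∑' i, ((‖inner ℂ (v i) (f k)‖₊ ^ 2 : ℝ≥0) : ℝ≥0∞) ≤ 1 := by
    intro k
    rw [tsum_nnnorm_inner_sq, show ‖f k‖₊ = 1 from NNReal.eq (f.orthonormal.1 k)]
    simp
  have := powLE_tsum hq0 hw (fun k => hv.tsum_nnnorm_sq (f k))
  refine this.trans (PowLE.of_eq (tsum_congr fun i => ?_))
  simp only [nnnorm_inner_comm (v i)]
  rw [tsum_nnnorm_inner_sq, show ‖v i‖₊ = 1 from NNReal.eq (v.orthonormal.1 i)]
  simp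

end SingularBasis

section Compact

variable {H : Type u} [NormedAddCommGroup H] [InnerProductSpace ℂ H] [CompleteSpace H]
  {K : Type*} [NormedAddCommGroup K] [InnerProductSpace ℂ K] [CompleteSpace K]

theorem exists_eigenbasis {T : H →L[ℂ] H} (hT : IsCompactOperator T)
    (hT' : (T : H →ₗ[ℂ] H).IsSymmetric) :
    ∃ (ι : Type u) (f : HilbertBasis ι ℂ H) (μ : ι → ℂ), ∀ i, T (f i) = μ i • f i := by
  let E : ℂ → Submodule ℂ H := fun μ => Module.End.eigenspace (T : H →ₗ[ℂ] H) μ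
  have hclosed : ∀ μ, IsClosed (E μ : Set H) := by
    intro μ
    have : (E μ : Set H) = {x | T x = μ • x} := by
      ext x
      exact Module.End.mem_eigenspace_iff
    rw [this]
    exact isClosed_eq T.continuous (continuous_const_smul μ)
  have : ∀ μ, CompleteSpace (E μ) := fun μ => (hclosed μ).completeSpace_coe
  choose w b hb using fun μ => exists_hilbertBasis ℂ (E μ)
  have horth : Orthonormal ℂ (fun i : Σ μ, w μ => ((b i.1 i.2 : E i.1) : H)) :=
    hT'.orthogonalFamily_eigenspaces.orthonormal_sigma_orthonormal fun μ => (b μ).orthonormal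
  have hspan : (Submodule.span ℂ (Set.range fun i : Σ μ, w μ => ((b i.1 i.2 : E i.1) : H)))ᗮ =
      ⊥ := by
    have hbot := ContinuousLinearMap.orthogonalComplement_iSup_eigenspaces_eq_bot hT hT'
    rw [eq_bot_iff, ← hbot, ← Submodule.iInf_orthogonal]
    refine fun x hx => (Submodule.mem_iInf _).2 fun μ => ?_
    rw [Submodule.mem_orthogonal] at hx ⊢
    intro y hy
    have hs := ((b μ).hasSum_repr ⟨y, hy⟩).mapL (E μ).subtypeL
    have hs' := hs.mapL (innerSL ℂ x)
    have hz : ∀ i, innerSL ℂ x ((E μ).subtypeL ((b μ).repr ⟨y, hy⟩ i • b μ i)) = 0 := by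
      intro i
      have := hx _ (Submodule.subset_span ⟨⟨μ, i⟩, rfl⟩)
      rw [inner_eq_zero_symm] at this
      simp [this]
    simp only [hz] at hs'
    have := hs'.unique hasSum_zero
    rw [inner_eq_zero_symm]
    simpa using this
  refine ⟨Σ μ, w μ, HilbertBasis.mkOfOrthogonalEqBot horth hspan, fun i => i.1, fun i => ?_⟩
  rw [HilbertBasis.coe_mkOfOrthogonalEqBot]
  exact Module.End.mem_eigenspace_iff.1 (b i.1 i.2).2

theorem exists_isSingularBasis {c : H →L[ℂ] K} (hc : IsCompactOperator c) :
    ∃ (ι : Type u) (f : HilbertBasis ι ℂ H), IsSingularBasis c f := by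
  have hT : IsCompactOperator (ContinuousLinearMap.adjoint c ∘L c) :=
    hc.clm_comp (ContinuousLinearMap.adjoint c)
  obtain ⟨ι, f, μ, hf⟩ := exists_eigenbasis hT
    (ContinuousLinearMap.isPositive_adjoint_comp_self c).isSymmetric
  refine ⟨ι, f, fun i k hik => ?_⟩
  rw [← ContinuousLinearMap.adjoint_inner_right]
  have := hf k
  rw [ContinuousLinearMap.comp_apply] at this
  rw [this, inner_smul_right, f.orthonormal.2 hik, mul_zero]

theorem isCompactOperator_adjoint {a : H →L[ℂ] K} (ha : IsCompactOperator a) :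
    IsCompactOperator (ContinuousLinearMap.adjoint a) := by
  set b := ContinuousLinearMap.adjoint a with hb
  have hab : IsCompactOperator (a ∘L b) := ha.comp_clm b
  refine (isCompactOperator_iff_isCompact_closure_image_ball (b : K →ₗ[ℂ] H) one_pos).2 ?_
  refine TotallyBounded.isCompact_of_isClosed ?_ isClosed_closure
  refine TotallyBounded.closure ?_
  have htb : TotallyBounded ((a ∘L b) '' Metric.ball 0 1) :=
    (hab.isCompact_closure_image_ball 1).totallyBounded.subset subset_closure
  have hkey : ∀ x y : K, ‖b x - b y‖ ^ 2 ≤ ‖(a ∘L b) x - (a ∘L b) y‖ * ‖x - y‖ := by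
    intro x y
    rw [← map_sub, ← map_sub]
    have : (‖b (x - y)‖ ^ 2 : ℝ) = (inner ℂ ((a ∘L b) (x - y)) (x - y)).re := by
      rw [ContinuousLinearMap.comp_apply, ← ContinuousLinearMap.adjoint_inner_right,
        ← hb, inner_self_eq_norm_sq_to_K]
      norm_cast
    rw [this]
    exact (Complex.re_le_norm _).trans (norm_inner_le_norm _ _)
  rw [Metric.totallyBounded_iff]
  intro ε hε
  obtain ⟨s, hs, hsf, hcov⟩ := Metric.finite_approx_of_totallyBounded htb (ε ^ 2 / 2) (by positivity)
  have hs' : ∀ y ∈ s, ∃ x, x ∈ Metric.ball (0 : K) 1 ∧ (a ∘L b) x = y := hs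
  choose! g hg using hs'
  refine ⟨b ∘ g '' s, hsf.image _, ?_⟩
  rintro _ ⟨x, hx, rfl⟩
  obtain ⟨y, hy, hxy⟩ := Set.mem_iUnion₂.1 (hcov ⟨x, hx, rfl⟩)
  refine Set.mem_iUnion₂.2 ⟨b (g y), ⟨y, hy, rfl⟩, ?_⟩
  obtain ⟨h1, h2⟩ := hg y hy
  rw [Metric.mem_ball, dist_eq_norm] at hxy ⊢
  rw [← h2] at hxy
  have h3 := hkey x (g y)
  have h4 : ‖x - g y‖ ≤ 2 := by
    have := norm_sub_le x (g y)
    rw [mem_ball_zero_iff] at hx h1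
    linarith
  refine lt_of_pow_lt_pow_left₀ 2 hε.le (h3.trans_lt ?_)
  nlinarith [norm_nonneg ((a ∘L b) x - (a ∘L b) (g y)), norm_nonneg (x - g y)]

end Compact

section SchattenNorm

variable {H : Type u} [NormedAddCommGroup H] [InnerProductSpace ℂ H] [CompleteSpace H]
  {ι : Type*}

open ContinuousLinearMap

theorem IsSingularBasis.adjoint_apply_apply {K : Type*} [NormedAddCommGroup K]
    [InnerProductSpace ℂ K] [CompleteSpace K] {c : H →L[ℂ] K} {f : HilbertBasis ι ℂ H}
    (hf : IsSingularBasis c f) (i : ι) :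
    adjoint c (c (f i)) = ((‖c (f i)‖ ^ 2 : ℝ) : ℂ) • f i := by
  refine ext_inner_right ℂ fun x => ?_
  rw [adjoint_inner_left, hf.inner_apply_apply, inner_smul_left, Complex.conj_ofReal]

theorem abs_apply_eq_iff (a : H →L[ℂ] H) {μ : ℝ} (hμ : 0 < μ) (x : H) :
    (CFC.abs a : H →L[ℂ] H) x = (μ : ℂ) • x ↔ adjoint a (a x) = ((μ ^ 2 : ℝ) : ℂ) • x := by
  have hsq : ∀ y, (CFC.abs a : H →L[ℂ] H) ((CFC.abs a : H →L[ℂ] H) y) = adjoint a (a y) := by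
    intro y
    have := congrArg (fun T : H →L[ℂ] H => T y) (CFC.abs_mul_abs a)
    simpa [ContinuousLinearMap.star_eq_adjoint] using this
  have hpos : (CFC.abs a : H →L[ℂ] H).IsPositive :=
    (ContinuousLinearMap.nonneg_iff_isPositive _).1 (CFC.abs_nonneg a)
  constructor
  · intro h
    rw [← hsq, h, map_smul, h, smul_smul]
    congr 1
    push_cast
    ring
  · intro h
    set y := (CFC.abs a : H →L[ℂ] H) x - (μ : ℂ) • x with hy
    have h1 : (CFC.abs a : H →L[ℂ] H) y = -((μ : ℂ) • y) := by
      rw [hy, map_sub, hsq, h, map_smul, smul_sub, smul_smul]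
      push_cast
      rw [← pow_two, neg_sub]
    have h2 := hpos.inner_nonneg_right y
    rw [h1, inner_neg_right, inner_smul_right, inner_self_eq_norm_sq_to_K] at h2
    have h3 : 0 ≤ -(μ * ‖y‖ ^ 2) := by
      have h2' := (Complex.le_def.1 h2).1
      norm_cast at h2'
      change 0 ≤ (-((μ : ℂ) * ((‖y‖ ^ 2 : ℝ) : ℂ))).re at h2'
      rwa [← Complex.ofReal_mul, ← Complex.ofReal_neg, Complex.ofReal_re] at h2'
    have h4 : ‖y‖ = 0 := by
      by_contra hne
      have : 0 < ‖y‖ := lt_of_le_of_ne (norm_nonneg y) (Ne.symm hne)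
      nlinarith [mul_pos hμ (pow_pos this 2)]
    exact sub_eq_zero.1 (norm_eq_zero.1 h4)

theorem IsSingularBasis.singularMultiplicity_eq {a : H →L[ℂ] H} (ha : IsCompactOperator a)
    {f : HilbertBasis ι ℂ H} (hf : IsSingularBasis a f) {μ : ℝ≥0} (hμ : 0 < μ) :
    (singularMultiplicity a μ : ℝ≥0∞) = ∑' _ : (fun i => ‖a (f i)‖₊) ⁻¹' {μ}, (1 : ℝ≥0∞) := by
  let E := Module.End.eigenspace ((CFC.abs a : H →L[ℂ] H) : H →ₗ[ℂ] H) ((μ : ℝ) : ℂ)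
  have hμ' : (0 : ℝ) < μ := hμ
  have hmem : ∀ x, x ∈ E ↔ adjoint a (a x) = (((μ : ℝ) ^ 2 : ℝ) : ℂ) • x := fun x =>
    Module.End.mem_eigenspace_iff.trans (abs_apply_eq_iff a hμ' x)
  let F : Set ι := (fun i => ‖a (f i)‖₊) ⁻¹' {μ}
  have hFE : ∀ i ∈ F, f i ∈ E := by
    intro i hi
    rw [hmem, hf.adjoint_apply_apply]
    have : ‖a (f i)‖ = μ := congrArg NNReal.toReal hi
    rw [this]
  have hfd : FiniteDimensional ℂ E := by
    have hE : E = Module.End.eigenspace ((adjoint a ∘L a : H →L[ℂ] H) : H →ₗ[ℂ] H)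
        (((μ : ℝ) ^ 2 : ℝ) : ℂ) := by
      ext x
      rw [hmem, Module.End.mem_eigenspace_iff]
      rfl
    rw [hE]
    exact finite_dimensional_eigenspace (ha.clm_comp (adjoint a))
      (((μ : ℝ) ^ 2 : ℝ) : ℂ) (by exact_mod_cast (pow_pos hμ' 2).ne')
  have hli : LinearIndependent ℂ (fun i : F => (⟨f i, hFE i i.2⟩ : E)) := by
    refine LinearIndependent.of_comp E.subtype ?_
    exact (f.orthonormal.linearIndependent.comp _ Subtype.val_injective)
  have hfin : Finite F := hli.finite
  have : Fintype F := Fintype.ofFinite F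
  have hspan : ⊤ ≤ Submodule.span ℂ (Set.range fun i : F => (⟨f i, hFE i i.2⟩ : E)) := by
    rintro ⟨x, hx⟩ -
    have hz : ∀ i, i ∉ F → inner ℂ (f i) x = 0 := by
      intro i hi
      have h1 := hf.inner_apply_apply i x
      rw [← adjoint_inner_right, (hmem x).1 hx, inner_smul_right, ← sub_eq_zero, ← sub_mul,
        mul_eq_zero] at h1
      refine h1.resolve_left fun h2 => hi ?_
      have h3 : (μ : ℝ) ^ 2 = ‖a (f i)‖ ^ 2 := by exact_mod_cast sub_eq_zero.1 h2
      exact NNReal.eq ((pow_left_inj₀ hμ'.le (norm_nonneg _) two_ne_zero).1 h3).symm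
    have hs := f.hasSum_repr x
    have hs' : HasSum (fun i => f.repr x i • f i) (∑ i : F, f.repr x i • f i) := by
      rw [Finset.sum_set_coe F (f := fun i => f.repr x i • f i)]
      exact hasSum_sum_of_ne_finset_zero fun i hi => by
        rw [f.repr_apply_apply, hz i (by simpa using hi), zero_smul]
    have hx' : (⟨x, hx⟩ : E) = ∑ i : F, f.repr x i • (⟨f i, hFE i i.2⟩ : E) := by
      apply Subtype.ext
      rw [AddSubmonoidClass.coe_finsetSum]
      exact hs.unique hs'
    rw [hx']
    exact Submodule.sum_mem _ fun i _ => Submodule.smul_mem _ _ (Submodule.subset_span ⟨i, rfl⟩)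
  have hcard : Module.finrank ℂ E = Fintype.card F :=
    Module.finrank_eq_card_basis (Module.Basis.mk hli hspan)
  rw [singularMultiplicity, show Module.finrank ℂ _ = _ from hcard, tsum_fintype]
  simp [F]

theorem schattenNorm_rpow_eq {p : ℝ} (hp : 0 < p) {a : H →L[ℂ] H} (ha : IsCompactOperator a)
    {f : HilbertBasis ι ℂ H} (hf : IsSingularBasis a f) :
    schattenNorm p a ^ p = powSum (p / 2) a f := by
  rw [schattenNorm, ← ENNReal.rpow_mul, one_div, inv_mul_cancel₀ hp.ne', ENNReal.rpow_one]
  rw [powSum_half, ← ENNReal.tsum_fiberwise _ (fun i => ‖a (f i)‖₊)]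
  refine tsum_congr fun μ => ?_
  have h2 : ∀ i : (fun i => ‖a (f i)‖₊) ⁻¹' {μ}, (‖a (f i)‖₊ : ℝ≥0∞) ^ p = 1 * (μ : ℝ≥0∞) ^ p := by
    intro i
    rw [one_mul, show ‖a (f i)‖₊ = μ from i.2]
  rw [tsum_congr h2, ENNReal.tsum_mul_right]
  rcases eq_zero_or_pos μ with rfl | hμ
  · simp [ENNReal.zero_rpow_of_pos hp]
  · rw [hf.singularMultiplicity_eq ha hμ]

end SchattenNorm

open ContinuousLinearMap

theorem tsum_rpow_eq_of_forall {ι κ : Type*} {q : ℝ} (hq0 : 0 < q) {w : κ → ι → ℝ≥0}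
    {t : ι → ℝ≥0} {s : κ → ℝ≥0} (hs : ∀ k, ∑' i, (w k i : ℝ≥0∞) * t i = s k)
    (h : ∀ k i, w k i ≠ 0 → t i = s k) :
    ∑' k, (s k : ℝ≥0∞) ^ q = ∑' i, (∑' k, (w k i : ℝ≥0∞)) * (t i : ℝ≥0∞) ^ q := by
  simp only [← ENNReal.tsum_mul_right]
  rw [ENNReal.tsum_comm]
  refine tsum_congr fun k => ?_
  have hr : ∀ (g : ℝ≥0 → ℝ≥0∞) i, (w k i : ℝ≥0∞) * g (t i) = (w k i : ℝ≥0∞) * g (s k) := by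
    intro g i
    by_cases hi : w k i = 0
    · simp [hi]
    · rw [h k i hi]
  rw [tsum_congr (hr fun x => (x : ℝ≥0∞) ^ q), ENNReal.tsum_mul_right]
  have h1 := hs k
  rw [tsum_congr (hr fun x => (x : ℝ≥0∞)), ENNReal.tsum_mul_right] at h1
  by_cases h0 : s k = 0
  · simp [h0, ENNReal.zero_rpow_of_pos hq0]
  · have h2 : ∑' i, (w k i : ℝ≥0∞) = 1 := by
      rw [← ENNReal.mul_left_inj (ENNReal.coe_ne_zero.2 h0) ENNReal.coe_ne_top, h1, one_mul]
    rw [h2, one_mul]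

section Compression

variable {H : Type u} [NormedAddCommGroup H] [InnerProductSpace ℂ H]
  {K : Type*} [NormedAddCommGroup K] [InnerProductSpace ℂ K]
  {G : Type*} [NormedAddCommGroup G] [InnerProductSpace ℂ G]
  {ι κ : Type*} {c : H →L[ℂ] K} {a : H →L[ℂ] G} {f : HilbertBasis ι ℂ H} {j : G → K}

/-- The weights that express `‖a* u‖²` as a sub-convex combination of the `‖c fᵢ‖²`. -/
def compressionWeight (c : H →L[ℂ] K) (a : H →L[ℂ] G) (f : ι → H) (u : κ → G)
    (k : κ) (i : ι) : ℝ≥0 :=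
  ‖inner ℂ (u k) (a (f i))‖₊ ^ 2 / ‖c (f i)‖₊ ^ 2

theorem eq_zero_of_apply_eq_zero (hinner : ∀ x y, inner ℂ (j x) (c y) = inner ℂ x (a y))
    {x : H} (hx : c x = 0) (y : G) : inner ℂ y (a x) = 0 := by
  rw [← hinner, hx, inner_zero_right]

theorem tsum_compressionWeight_le (hf : IsSingularBasis c f) (hj : ∀ x, ‖j x‖ = ‖x‖)
    (hinner : ∀ x y, inner ℂ (j x) (c y) = inner ℂ x (a y)) (u : HilbertBasis κ ℂ G) (k : κ) :
    ∑' i, (compressionWeight c a f u k i : ℝ≥0∞) ≤ 1 := by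
  have := tsum_inner_div_le (y := fun i => c (f i)) hf (j (u k))
  rw [show ‖j (u k)‖₊ = 1 from NNReal.eq ((hj _).trans (u.orthonormal.1 k))] at this
  simpa [compressionWeight, hinner] using this

theorem tsum_compressionWeight_left (u : HilbertBasis κ ℂ G) (i : ι) :
    ∑' k, (compressionWeight c a f u k i : ℝ≥0∞) =
      ((‖a (f i)‖₊ ^ 2 / ‖c (f i)‖₊ ^ 2 : ℝ≥0) : ℝ≥0∞) := by
  by_cases h0 : c (f i) = 0
  · simp [compressionWeight, h0]
  · have h0' := pow_ne_zero 2 (nnnorm_ne_zero_iff.2 h0)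
    simp only [compressionWeight, div_eq_mul_inv]
    simp only [ENNReal.coe_mul]
    rw [ENNReal.tsum_mul_right, tsum_nnnorm_inner_sq]

variable [CompleteSpace H] [CompleteSpace G]

theorem tsum_compressionWeight_mul (hinner : ∀ x y, inner ℂ (j x) (c y) = inner ℂ x (a y))
    (u : HilbertBasis κ ℂ G) (k : κ) :
    ∑' i, (compressionWeight c a f u k i : ℝ≥0∞) * ((‖c (f i)‖₊ ^ 2 : ℝ≥0) : ℝ≥0∞) =
      ((‖adjoint a (u k)‖₊ ^ 2 : ℝ≥0) : ℝ≥0∞) := by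
  rw [← tsum_nnnorm_inner_sq f]
  refine tsum_congr fun i => ?_
  rw [← ENNReal.coe_mul, compressionWeight, nnnorm_inner_comm (f i), adjoint_inner_left]
  by_cases h0 : c (f i) = 0
  · simp [eq_zero_of_apply_eq_zero hinner h0]
  · rw [div_mul_cancel₀ _ (pow_ne_zero 2 (nnnorm_ne_zero_iff.2 h0))]

theorem powLE_powSum_adjoint {q : ℝ} (hq0 : 0 < q) (hf : IsSingularBasis c f)
    (hj : ∀ x, ‖j x‖ = ‖x‖) (hinner : ∀ x y, inner ℂ (j x) (c y) = inner ℂ x (a y))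
    (u : HilbertBasis κ ℂ G) :
    PowLE q (powSum q (adjoint a) u)
      (∑' i, ((‖a (f i)‖₊ ^ 2 / ‖c (f i)‖₊ ^ 2 : ℝ≥0) : ℝ≥0∞) *
        ((‖c (f i)‖₊ ^ 2 : ℝ≥0) : ℝ≥0∞) ^ q) := by
  have := powLE_tsum hq0 (tsum_compressionWeight_le hf hj hinner u)
    (tsum_compressionWeight_mul (f := f) hinner u)
  simpa only [powSum, tsum_compressionWeight_left] using this

theorem norm_eq_of_powSum_adjoint_eq {q : ℝ} (hq0 : 0 < q) (hq1 : q ≠ 1)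
    (hf : IsSingularBasis c f)
    (hj : ∀ x, ‖j x‖ = ‖x‖) (hinner : ∀ x y, inner ℂ (j x) (c y) = inner ℂ x (a y))
    (u : HilbertBasis κ ℂ G)
    (heq : powSum q (adjoint a) u = ∑' i, ((‖a (f i)‖₊ ^ 2 / ‖c (f i)‖₊ ^ 2 : ℝ≥0) : ℝ≥0∞) *
        ((‖c (f i)‖₊ ^ 2 : ℝ≥0) : ℝ≥0∞) ^ q)
    (hfin : powSum q (adjoint a) u ≠ ∞) {k : κ} {i : ι} (hki : inner ℂ (u k) (a (f i)) ≠ 0) :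
    ‖c (f i)‖ = ‖adjoint a (u k)‖ := by
  have hw : compressionWeight c a f u k i ≠ 0 := by
    refine div_ne_zero (pow_ne_zero 2 (nnnorm_ne_zero_iff.2 hki)) (pow_ne_zero 2 ?_)
    exact nnnorm_ne_zero_iff.2 fun h => hki (eq_zero_of_apply_eq_zero hinner h _)
  have := eq_of_powLE_tsum_eq hq0 hq1 (tsum_compressionWeight_le hf hj hinner u)
    (tsum_compressionWeight_mul (f := f) hinner u)
    (by simpa only [powSum, tsum_compressionWeight_left] using heq) hfin hw
  have := (pow_left_inj₀ (zero_le) (zero_le) two_ne_zero).1 this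
  exact congrArg NNReal.toReal this

theorem powSum_adjoint_eq_of_forall {q : ℝ} (hq0 : 0 < q)
    (hinner : ∀ x y, inner ℂ (j x) (c y) = inner ℂ x (a y)) (u : HilbertBasis κ ℂ G)
    (h : ∀ k i, inner ℂ (u k) (a (f i)) ≠ 0 → ‖c (f i)‖ = ‖adjoint a (u k)‖) :
    powSum q (adjoint a) u = ∑' i, ((‖a (f i)‖₊ ^ 2 / ‖c (f i)‖₊ ^ 2 : ℝ≥0) : ℝ≥0∞) *
        ((‖c (f i)‖₊ ^ 2 : ℝ≥0) : ℝ≥0∞) ^ q := by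
  have := tsum_rpow_eq_of_forall hq0 (tsum_compressionWeight_mul (f := f) hinner u)
    (fun k i hki => by
      rw [show ‖c (f i)‖₊ = ‖adjoint a (u k)‖₊ from NNReal.eq (h k i ?_)]
      intro h0
      exact hki (by simp [compressionWeight, h0]))
  simpa only [powSum, tsum_compressionWeight_left] using this

end Compression

section Column

variable {H : Type u} [NormedAddCommGroup H] [InnerProductSpace ℂ H] {ι : Type*}

/-- The column operator with entries `a` and `b`. -/
def column (a b : H →L[ℂ] H) : H →L[ℂ] WithLp 2 (H × H) :=
  ((WithLp.prodContinuousLinearEquiv 2 ℂ H H).symm : (H × H) →L[ℂ] WithLp 2 (H × H)) ∘L a.prod b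

theorem inner_column (a b : H →L[ℂ] H) (x y : H) :
    inner ℂ (column a b x) (column a b y) = inner ℂ (a x) (a y) + inner ℂ (b x) (b y) := rfl

theorem norm_column_sq (a b : H →L[ℂ] H) (x : H) :
    ‖column a b x‖ ^ 2 = ‖a x‖ ^ 2 + ‖b x‖ ^ 2 := by
  rw [WithLp.prod_norm_sq_eq_of_L2]
  rfl

theorem nnnorm_column_sq (a b : H →L[ℂ] H) (x : H) :
    ‖column a b x‖₊ ^ 2 = ‖a x‖₊ ^ 2 + ‖b x‖₊ ^ 2 :=
  NNReal.eq (by simpa using norm_column_sq a b x)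

theorem isCompactOperator_column {a b : H →L[ℂ] H} (ha : IsCompactOperator a)
    (hb : IsCompactOperator b) : IsCompactOperator (column a b) := by
  have h1 := (ha.clm_comp (inl ℂ H H)).add (hb.clm_comp (inr ℂ H H))
  have h2 := h1.clm_comp
    ((WithLp.prodContinuousLinearEquiv 2 ℂ H H).symm : (H × H) →L[ℂ] WithLp 2 (H × H))
  have h3 : (column a b : H → WithLp 2 (H × H)) =
      ((WithLp.prodContinuousLinearEquiv 2 ℂ H H).symm : (H × H) →L[ℂ] WithLp 2 (H × H)) ∘
        (inl ℂ H H ∘ a + inr ℂ H H ∘ b) := by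
    funext x
    simp [column]
  rw [h3]
  exact h2

theorem inner_inl_column (a b : H →L[ℂ] H) (x y : H) :
    inner ℂ (WithLp.toLp 2 (x, (0 : H))) (column a b y) = inner ℂ x (a y) := by
  rw [WithLp.prod_inner_apply]
  simp [column]

theorem inner_inr_column (a b : H →L[ℂ] H) (x y : H) :
    inner ℂ (WithLp.toLp 2 ((0 : H), x)) (column a b y) = inner ℂ x (b y) := by
  rw [WithLp.prod_inner_apply]
  simp [column]

theorem tsum_column_split {q : ℝ} (hq0 : 0 < q) (a b : H →L[ℂ] H) (f : ι → H) :
    (∑' i, ((‖a (f i)‖₊ ^ 2 / ‖column a b (f i)‖₊ ^ 2 : ℝ≥0) : ℝ≥0∞) *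
        ((‖column a b (f i)‖₊ ^ 2 : ℝ≥0) : ℝ≥0∞) ^ q) +
      (∑' i, ((‖b (f i)‖₊ ^ 2 / ‖column a b (f i)‖₊ ^ 2 : ℝ≥0) : ℝ≥0∞) *
        ((‖column a b (f i)‖₊ ^ 2 : ℝ≥0) : ℝ≥0∞) ^ q) = powSum q (column a b) f := by
  rw [← ENNReal.tsum_add]
  refine tsum_congr fun i => ?_
  rw [← add_mul, ← ENNReal.coe_add, ← add_div, ← nnnorm_column_sq]
  by_cases h0 : column a b (f i) = 0
  · simp [h0, ENNReal.zero_rpow_of_pos hq0]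
  · rw [div_self (pow_ne_zero 2 (nnnorm_ne_zero_iff.2 h0)), ENNReal.coe_one, one_mul]

end Column

section Clarkson

variable {H : Type u} [NormedAddCommGroup H] [InnerProductSpace ℂ H] [CompleteSpace H]
  {ι : Type*}

theorem powSum_adjoint_powLE {q : ℝ} (hq0 : 0 < q) {a : H →L[ℂ] H} {f : HilbertBasis ι ℂ H}
    (hf : IsSingularBasis a f) {κ : Type*} (u : HilbertBasis κ ℂ H) :
    PowLE q (powSum q (adjoint a) u) (powSum q a f) := by
  refine (powLE_powSum_adjoint (j := id) hq0 hf (fun _ => rfl) (fun _ _ => rfl) u).trans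
    (PowLE.of_eq (tsum_congr fun i => ?_))
  by_cases h0 : a (f i) = 0
  · simp [h0, ENNReal.zero_rpow_of_pos hq0]
  · rw [div_self (pow_ne_zero 2 (nnnorm_ne_zero_iff.2 h0)), ENNReal.coe_one, one_mul]

theorem schattenNorm_adjoint_rpow {p : ℝ} (hp : 0 < p) (hp2 : p ≠ 2) {a : H →L[ℂ] H}
    (ha : IsCompactOperator a) : schattenNorm p (adjoint a) ^ p = schattenNorm p a ^ p := by
  have hq0 : 0 < p / 2 := by positivity
  have hq1 : p / 2 ≠ 1 := fun h => hp2 (by linarith)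
  obtain ⟨ι, f, hf⟩ := exists_isSingularBasis ha
  obtain ⟨κ, u, hu⟩ := exists_isSingularBasis (isCompactOperator_adjoint ha)
  rw [schattenNorm_rpow_eq hp ha hf, schattenNorm_rpow_eq hp (isCompactOperator_adjoint ha) hu]
  refine PowLE.antisymm hq1 (powSum_adjoint_powLE hq0 hf u) ?_
  have := powSum_adjoint_powLE hq0 hu f
  rwa [adjoint_adjoint] at this

theorem schattenNorm_add_powLE_column {p : ℝ} (hp : 0 < p) (hp2 : p ≠ 2) {a b : H →L[ℂ] H}
    (ha : IsCompactOperator a) (hb : IsCompactOperator b) {f : HilbertBasis ι ℂ H}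
    (hf : IsSingularBasis (column a b) f) :
    PowLE (p / 2) (schattenNorm p a ^ p + schattenNorm p b ^ p)
      (powSum (p / 2) (column a b) f) := by
  have hq0 : 0 < p / 2 := by positivity
  obtain ⟨κ, u, hu⟩ := exists_isSingularBasis (isCompactOperator_adjoint ha)
  obtain ⟨κ', u', hu'⟩ := exists_isSingularBasis (isCompactOperator_adjoint hb)
  rw [← schattenNorm_adjoint_rpow hp hp2 ha, ← schattenNorm_adjoint_rpow hp hp2 hb,
    schattenNorm_rpow_eq hp (isCompactOperator_adjoint ha) hu,
    schattenNorm_rpow_eq hp (isCompactOperator_adjoint hb) hu', ← tsum_column_split hq0]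
  exact (powLE_powSum_adjoint hq0 hf (fun x => by simp) (inner_inl_column a b) u).add
    (powLE_powSum_adjoint hq0 hf (fun x => by simp) (inner_inr_column a b) u')

theorem column_powLE_schattenNorm {p : ℝ} (hp : 0 < p) {a b : H →L[ℂ] H}
    (ha : IsCompactOperator a) (hb : IsCompactOperator b) (f : HilbertBasis ι ℂ H) :
    PowLE (p / 2) (2 * powSum (p / 2) (column a b) f)
      (schattenNorm p (a + b) ^ p + schattenNorm p (a - b) ^ p) := by
  have hq0 : 0 < p / 2 := by positivity
  have hab : IsCompactOperator (a + b) := ha.add hb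
  have hab' : IsCompactOperator (a - b) := ha.sub hb
  obtain ⟨κ, v, hv⟩ := exists_isSingularBasis hab
  obtain ⟨κ', v', hv'⟩ := exists_isSingularBasis hab'
  rw [schattenNorm_rpow_eq hp hab hv, schattenNorm_rpow_eq hp hab' hv']
  refine PowLE.trans ?_ ((powLE_powSum hq0 hv f).add (powLE_powSum hq0 hv' f))
  rw [powSum, ← ENNReal.tsum_mul_left, powSum, powSum, ← ENNReal.tsum_add]
  refine PowLE.tsum fun i => ?_
  convert powLE_two_mul_add_div_two hq0 (‖(a + b) (f i)‖₊ ^ 2) (‖(a - b) (f i)‖₊ ^ 2) using 4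
  apply NNReal.eq
  push_cast
  have := parallelogram_law_with_norm ℂ (a (f i)) (b (f i))
  rw [norm_column_sq, Pi.add_apply, Pi.sub_apply]
  linarith

/-- An equality case of the Clarkson–McCarthy inequality. -/
theorem comp_adjoint_eq_zero_of_clarkson_eq {p : ℝ} (hp : 0 < p) (hp2 : p ≠ 2)
    {a b : H →L[ℂ] H} (ha : IsCompactOperator a) (hb : IsCompactOperator b)
    (hfa : schattenNorm p a ^ p ≠ ∞) (hfb : schattenNorm p b ^ p ≠ ∞)
    (heq : schattenNorm p (a + b) ^ p + schattenNorm p (a - b) ^ p =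
      2 * (schattenNorm p a ^ p + schattenNorm p b ^ p)) :
    b ∘L adjoint a = 0 := by
  have hq0 : 0 < p / 2 := by positivity
  have hq1 : p / 2 ≠ 1 := fun h => hp2 (by linarith)
  obtain ⟨ι, f, hf⟩ := exists_isSingularBasis (isCompactOperator_column ha hb)
  have h1 := schattenNorm_add_powLE_column hp hp2 ha hb hf
  have h2 := column_powLE_schattenNorm hp ha hb f
  rw [heq] at h2
  have h3 := (h1.mul_left 2).antisymm hq1 h2
  have h4 : schattenNorm p a ^ p + schattenNorm p b ^ p = powSum (p / 2) (column a b) f := by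
    rwa [ENNReal.mul_right_inj two_ne_zero ENNReal.ofNat_ne_top] at h3
  obtain ⟨κ, u, hu⟩ := exists_isSingularBasis (isCompactOperator_adjoint ha)
  obtain ⟨κ', u', hu'⟩ := exists_isSingularBasis (isCompactOperator_adjoint hb)
  have hfin := ENNReal.add_ne_top.2 ⟨hfa, hfb⟩
  rw [← schattenNorm_adjoint_rpow hp hp2 ha] at h4 hfin hfa
  rw [← schattenNorm_adjoint_rpow hp hp2 hb] at h4 hfin
  rw [schattenNorm_rpow_eq hp (isCompactOperator_adjoint ha) hu] at h4 hfin hfa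
  rw [schattenNorm_rpow_eq hp (isCompactOperator_adjoint hb) hu'] at h4 hfin
  rw [← tsum_column_split hq0] at h4
  have h5 := (PowLE.eq_of_add_eq hq1
    (powLE_powSum_adjoint hq0 hf (fun x => by simp) (inner_inl_column a b) u)
    (powLE_powSum_adjoint hq0 hf (fun x => by simp) (inner_inr_column a b) u') h4 hfin).1
  have h6 : ∀ k, b (adjoint a (u k)) = 0 := by
    intro k
    set y := adjoint a (u k) with hy
    have h7 : HasSum (fun i => ‖inner ℂ (f i) y‖ ^ 2 * ‖y‖ ^ 2) (‖column a b y‖ ^ 2) := by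
      convert hf.hasSum_norm_sq y using 2 with i
      by_cases h0 : inner ℂ (f i) y = 0
      · simp [h0]
      · rw [norm_eq_of_powSum_adjoint_eq hq0 hq1 hf (fun x => by simp) (inner_inl_column a b) u h5 hfa
          (k := k)]
        rwa [Ne, ← inner_eq_zero_symm, ← adjoint_inner_right]
    have h8 : HasSum (fun i => ‖inner ℂ (f i) y‖ ^ 2 * ‖y‖ ^ 2) (‖y‖ ^ 2 * ‖y‖ ^ 2) := by
      have hid : IsSingularBasis (ContinuousLinearMap.id ℂ H) f :=
        fun i k hik => f.orthonormal.2 hik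
      have := (hid.hasSum_norm_sq y).mul_right (‖y‖ ^ 2)
      simpa [f.orthonormal.1] using this
    have h9 := h7.unique h8
    rw [norm_column_sq] at h9
    have h10 : ‖y‖ ^ 2 ≤ ‖a y‖ := by
      have := norm_inner_le_norm (𝕜 := ℂ) (u k) (a y)
      rw [← adjoint_inner_left, ← hy, u.orthonormal.1 k, one_mul, inner_self_eq_norm_sq_to_K] at this
      simpa using this
    have h11 : ‖b y‖ ^ 2 ≤ 0 := by nlinarith [sq_nonneg ‖y‖]
    exact norm_eq_zero.1 (pow_eq_zero_iff two_ne_zero |>.1 (le_antisymm h11 (sq_nonneg _)))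
  ext x
  have := hasSum_apply (b ∘L adjoint a) u x
  simp only [comp_apply, h6, smul_zero] at this
  exact this.unique hasSum_zero

/-- Orthogonality of operators: `b a* = 0` and `b* a = 0`. -/
def Orth (a b : H →L[ℂ] H) : Prop := b ∘L adjoint a = 0 ∧ adjoint b ∘L a = 0

theorem Orth.symm {a b : H →L[ℂ] H} (h : Orth a b) : Orth b a := by
  refine ⟨?_, ?_⟩
  · rw [← adjoint_adjoint (a ∘L adjoint b), adjoint_comp, adjoint_adjoint, h.1, map_zero]
  · rw [← adjoint_adjoint (adjoint a ∘L b), adjoint_comp, adjoint_adjoint, h.2, map_zero]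

theorem orth_of_clarkson_eq {p : ℝ} (hp : 0 < p) (hp2 : p ≠ 2)
    {a b : H →L[ℂ] H} (ha : IsCompactOperator a) (hb : IsCompactOperator b)
    (hfa : schattenNorm p a ^ p ≠ ∞) (hfb : schattenNorm p b ^ p ≠ ∞)
    (heq : schattenNorm p (a + b) ^ p + schattenNorm p (a - b) ^ p =
      2 * (schattenNorm p a ^ p + schattenNorm p b ^ p)) : Orth a b := by
  refine ⟨comp_adjoint_eq_zero_of_clarkson_eq hp hp2 ha hb hfa hfb heq, ?_⟩
  have hab : IsCompactOperator (a + b) := ha.add hb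
  have hab' : IsCompactOperator (a - b) := ha.sub hb
  rw [← schattenNorm_adjoint_rpow hp hp2 ha] at hfa heq
  rw [← schattenNorm_adjoint_rpow hp hp2 hb] at hfb heq
  rw [← schattenNorm_adjoint_rpow hp hp2 hab, ← schattenNorm_adjoint_rpow hp hp2 hab', map_add,
    map_sub] at heq
  have := comp_adjoint_eq_zero_of_clarkson_eq hp hp2 (isCompactOperator_adjoint ha)
    (isCompactOperator_adjoint hb) hfa hfb heq
  rwa [adjoint_adjoint] at this

theorem Orth.inner_eq_zero {a b : H →L[ℂ] H} (h : Orth a b) (x y : H) :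
    inner ℂ (a x) (b y) = 0 := by
  rw [← adjoint_inner_left, ← comp_apply, h.2, zero_apply, inner_zero_left]

theorem Orth.powSum_adjoint_eq {q : ℝ} (hq0 : 0 < q) {a b : H →L[ℂ] H} (h : b ∘L adjoint a = 0)
    {K : Type*} [NormedAddCommGroup K] [InnerProductSpace ℂ K] {c : H →L[ℂ] K}
    (hc : ∀ x y, inner ℂ (c x) (c y) = inner ℂ (a x) (a y) + inner ℂ (b x) (b y))
    {j : H → K} (hinner : ∀ x y, inner ℂ (j x) (c y) = inner ℂ x (a y))
    {f : HilbertBasis ι ℂ H} (hf : IsSingularBasis c f) {κ : Type*} {u : HilbertBasis κ ℂ H}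
    (hu : IsSingularBasis (adjoint a) u) :
    powSum q (adjoint a) u = ∑' i, ((‖a (f i)‖₊ ^ 2 / ‖c (f i)‖₊ ^ 2 : ℝ≥0) : ℝ≥0∞) *
        ((‖c (f i)‖₊ ^ 2 : ℝ≥0) : ℝ≥0∞) ^ q := by
  refine powSum_adjoint_eq_of_forall hq0 hinner u fun k i hki => ?_
  have h1 := hf.inner_apply_apply i (adjoint a (u k))
  have h2 := hu.adjoint_apply_apply k
  rw [adjoint_adjoint] at h2
  rw [hc, ← comp_apply b, h, zero_apply, inner_zero_right, add_zero, h2, inner_smul_right,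
    adjoint_inner_right] at h1
  have h3 := mul_right_cancel₀ (fun h0 => hki (inner_eq_zero_symm.1 h0)) h1
  have h4 : ‖adjoint a (u k)‖ ^ 2 = ‖c (f i)‖ ^ 2 := by exact_mod_cast h3
  exact ((pow_left_inj₀ (norm_nonneg _) (norm_nonneg _) two_ne_zero).1 h4).symm

theorem Orth.column_eq {p : ℝ} (hp : 0 < p) (hp2 : p ≠ 2) {a b : H →L[ℂ] H}
    (ha : IsCompactOperator a) (hb : IsCompactOperator b) (h : Orth a b)
    {f : HilbertBasis ι ℂ H} (hf : IsSingularBasis (column a b) f) :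
    schattenNorm p a ^ p + schattenNorm p b ^ p = powSum (p / 2) (column a b) f := by
  have hq0 : 0 < p / 2 := by positivity
  obtain ⟨κ, u, hu⟩ := exists_isSingularBasis (isCompactOperator_adjoint ha)
  obtain ⟨κ', u', hu'⟩ := exists_isSingularBasis (isCompactOperator_adjoint hb)
  rw [← schattenNorm_adjoint_rpow hp hp2 ha, ← schattenNorm_adjoint_rpow hp hp2 hb,
    schattenNorm_rpow_eq hp (isCompactOperator_adjoint ha) hu,
    schattenNorm_rpow_eq hp (isCompactOperator_adjoint hb) hu', ← tsum_column_split hq0,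
    Orth.powSum_adjoint_eq hq0 h.1 (inner_column a b) (inner_inl_column a b) hf hu,
    Orth.powSum_adjoint_eq hq0 h.symm.1 (fun x y => (inner_column a b x y).trans (add_comm _ _))
      (inner_inr_column a b) hf hu']

theorem Orth.schattenNorm_add {p : ℝ} (hp : 0 < p) (hp2 : p ≠ 2) {a b : H →L[ℂ] H}
    (ha : IsCompactOperator a) (hb : IsCompactOperator b) (h : Orth a b) :
    schattenNorm p (a + b) ^ p = schattenNorm p a ^ p + schattenNorm p b ^ p := by
  obtain ⟨ι, f, hf⟩ := exists_isSingularBasis (isCompactOperator_column ha hb)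
  have hinner : ∀ x y, inner ℂ ((a + b) x) ((a + b) y) =
      inner ℂ (column a b x) (column a b y) := by
    intro x y
    rw [inner_column, add_apply, add_apply, inner_add_left, inner_add_right, inner_add_right,
      h.inner_eq_zero, h.symm.inner_eq_zero, add_zero, zero_add]
  have hab : IsCompactOperator (a + b) := ha.add hb
  have hf' : IsSingularBasis (a + b) f := fun i k hik => (hinner _ _).trans (hf i k hik)
  rw [h.column_eq hp hp2 ha hb hf, schattenNorm_rpow_eq hp hab hf']
  refine tsum_congr fun i => ?_
  have h1 : ‖(a + b) (f i)‖ = ‖column a b (f i)‖ := by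
    rw [@norm_eq_sqrt_re_inner ℂ, hinner, ← norm_eq_sqrt_re_inner]
  rw [show ‖(a + b) (f i)‖₊ = ‖column a b (f i)‖₊ from NNReal.eq h1]

theorem Orth.neg_right {a b : H →L[ℂ] H} (h : Orth a b) : Orth a (-b) := by
  refine ⟨?_, ?_⟩
  · rw [neg_comp, h.1, neg_zero]
  · rw [map_neg, neg_comp, h.2, neg_zero]

end Clarkson

theorem two_mul_add_div_two_rpow_le {p : ℝ} (hp : 1 < p) (x y : ℝ≥0) :
    2 * (((x + y) / 2 : ℝ≥0) : ℝ≥0∞) ^ p ≤ (x : ℝ≥0∞) ^ p + (y : ℝ≥0∞) ^ p :=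
  (powLE_two_mul_add_div_two (by linarith) x y).1 hp

theorem eq_of_two_mul_add_div_two_rpow_eq {p : ℝ} (hp : 1 < p) {x y : ℝ≥0}
    (h : 2 * (((x + y) / 2 : ℝ≥0) : ℝ≥0∞) ^ p = (x : ℝ≥0∞) ^ p + (y : ℝ≥0∞) ^ p) : x = y := by
  by_contra hne
  have hp0 : 0 ≤ p := by linarith
  have := (strictConvexOn_rpow hp).2 (Set.mem_Ici.2 x.coe_nonneg) (Set.mem_Ici.2 y.coe_nonneg)
    (fun h => hne (NNReal.eq h)) (by norm_num : (0 : ℝ) < 1 / 2) (by norm_num : (0 : ℝ) < 1 / 2)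
    (by norm_num)
  simp only [← ENNReal.coe_rpow_of_nonneg _ hp0] at h
  have h' : 2 * (((x : ℝ) + y) / 2) ^ p = (x : ℝ) ^ p + (y : ℝ) ^ p := by exact_mod_cast h
  simp only [smul_eq_mul] at this
  rw [show (1 / 2 : ℝ) * x + 1 / 2 * y = ((x : ℝ) + y) / 2 by ring] at this
  linarith

theorem nnnorm_le_one_of_eq_zero_or {E ι : Type*} [NormedAddCommGroup E] {g : ι → E} {i : ι}
    (hg1 : ∀ i, g i = 0 ∨ ‖g i‖ = 1) :
    ‖g i‖₊ ^ 2 ≤ 1 := by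
  rcases hg1 i with h | h
  · simp [h]
  · rw [show ‖g i‖₊ = 1 from NNReal.eq h, one_pow]

section Diagonal

variable {H : Type u} [NormedAddCommGroup H] [InnerProductSpace ℂ H]
  {ι κ : Type*} {a : H →L[ℂ] H} {v : HilbertBasis ι ℂ H} {w : HilbertBasis κ ℂ H} {g : ι → H}

/-- The weights that bound `|⟪gᵢ, a vᵢ⟫|` by a sub-convex combination of the `‖a wⱼ‖`. -/
def diagonalWeight (a : H →L[ℂ] H) (v : ι → H) (g : ι → H) (w : κ → H) (i : ι) (j : κ) : ℝ≥0 :=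
  (‖g i‖₊ ^ 2 * ‖inner ℂ (w j) (v i)‖₊ ^ 2 +
    ‖inner ℂ (g i) (a (w j))‖₊ ^ 2 / ‖a (w j)‖₊ ^ 2) / 2

theorem coe_diagonalWeight (a : H →L[ℂ] H) (v : ι → H) (g : ι → H) (w : κ → H) (i : ι) (j : κ) :
    (diagonalWeight a v g w i j : ℝ≥0∞) =
      (((‖g i‖₊ ^ 2 : ℝ≥0) : ℝ≥0∞) * ((‖inner ℂ (w j) (v i)‖₊ ^ 2 : ℝ≥0) : ℝ≥0∞) +
        ((‖inner ℂ (g i) (a (w j))‖₊ ^ 2 / ‖a (w j)‖₊ ^ 2 : ℝ≥0) : ℝ≥0∞)) * 2⁻¹ := by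
  rw [diagonalWeight, ENNReal.coe_div two_ne_zero, ENNReal.coe_add, ENNReal.coe_mul,
    div_eq_mul_inv]
  rfl

theorem add_mul_half_le_one {x y : ℝ≥0∞} (hx : x ≤ 1) (hy : y ≤ 1) : (x + y) * 2⁻¹ ≤ 1 := by
  calc (x + y) * 2⁻¹ ≤ (1 + 1) * 2⁻¹ := by gcongr
    _ = 1 := by rw [one_add_one_eq_two, ENNReal.mul_inv_cancel two_ne_zero ENNReal.ofNat_ne_top]

theorem tsum_diagonalWeight_right_le (hw : IsSingularBasis a w)
    (hg1 : ∀ i, g i = 0 ∨ ‖g i‖ = 1) (i : ι) :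
    ∑' j, (diagonalWeight a v g w i j : ℝ≥0∞) ≤ 1 := by
  simp only [coe_diagonalWeight]
  rw [ENNReal.tsum_mul_right, ENNReal.tsum_add, ENNReal.tsum_mul_left, tsum_nnnorm_inner_sq,
    show ‖v i‖₊ = 1 from NNReal.eq (v.orthonormal.1 i)]
  have h := nnnorm_le_one_of_eq_zero_or (i := i) hg1
  refine add_mul_half_le_one ?_ ?_
  · rw [one_pow, ENNReal.coe_one, mul_one]
    exact_mod_cast h
  · exact (tsum_inner_div_le (y := fun j => a (w j)) hw (g i)).trans (by exact_mod_cast h)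

theorem tsum_mul_inner_le (hg1 : ∀ i, g i = 0 ∨ ‖g i‖ = 1) (j : κ) :
    ∑' i, ((‖g i‖₊ ^ 2 : ℝ≥0) : ℝ≥0∞) * ((‖inner ℂ (w j) (v i)‖₊ ^ 2 : ℝ≥0) : ℝ≥0∞) ≤ 1 := by
  have h1 : ∑' i, ((‖inner ℂ (w j) (v i)‖₊ ^ 2 : ℝ≥0) : ℝ≥0∞) = 1 := by
    simp only [nnnorm_inner_comm (w j)]
    rw [tsum_nnnorm_inner_sq, show ‖w j‖₊ = 1 from NNReal.eq (w.orthonormal.1 j)]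
    simp
  rw [← h1]
  refine ENNReal.tsum_le_tsum fun i => mul_le_of_le_one_left' ?_
  exact_mod_cast nnnorm_le_one_of_eq_zero_or hg1

theorem tsum_inner_div_norm_le (hg : ∀ i k, i ≠ k → inner ℂ (g i) (g k) = 0)
    (hg1 : ∀ i, g i = 0 ∨ ‖g i‖ = 1) (j : κ) :
    ∑' i, ((‖inner ℂ (g i) (a (w j))‖₊ ^ 2 / ‖a (w j)‖₊ ^ 2 : ℝ≥0) : ℝ≥0∞) ≤ 1 := by
  by_cases h0 : a (w j) = 0
  · simp [h0]
  have h0' := pow_ne_zero 2 (nnnorm_ne_zero_iff.2 h0)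
  have h1 := tsum_inner_div_le hg (a (w j))
  have h2 : ∀ i, ((‖inner ℂ (a (w j)) (g i)‖₊ ^ 2 / ‖g i‖₊ ^ 2 : ℝ≥0) : ℝ≥0∞) =
      ((‖inner ℂ (g i) (a (w j))‖₊ ^ 2 : ℝ≥0) : ℝ≥0∞) := by
    intro i
    rw [nnnorm_inner_comm]
    rcases hg1 i with h | h
    · simp [h]
    · rw [show ‖g i‖₊ = 1 from NNReal.eq h, one_pow, div_one]
  rw [tsum_congr h2] at h1
  simp only [ENNReal.coe_div h0']
  simp only [div_eq_mul_inv]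
  rw [ENNReal.tsum_mul_right, ← div_eq_mul_inv]
  exact ENNReal.div_le_of_le_mul (by rwa [one_mul])

theorem tsum_diagonalWeight_left_eq (j : κ) :
    ∑' i, (diagonalWeight a v g w i j : ℝ≥0∞) =
    (∑' i, ((‖g i‖₊ ^ 2 : ℝ≥0) : ℝ≥0∞) * ((‖inner ℂ (w j) (v i)‖₊ ^ 2 : ℝ≥0) : ℝ≥0∞) +
      ∑' i, ((‖inner ℂ (g i) (a (w j))‖₊ ^ 2 / ‖a (w j)‖₊ ^ 2 : ℝ≥0) : ℝ≥0∞)) * 2⁻¹ := by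
  simp only [coe_diagonalWeight]
  rw [ENNReal.tsum_mul_right, ENNReal.tsum_add]

theorem nnnorm_inner_mul_le (hg1 : ∀ i, g i = 0 ∨ ‖g i‖ = 1) (i : ι) (j : κ) :
    ‖inner ℂ (w j) (v i) * inner ℂ (g i) (a (w j))‖₊ ≤
      diagonalWeight a v g w i j * ‖a (w j)‖₊ := by
  rw [nnnorm_mul, diagonalWeight]
  by_cases h0 : a (w j) = 0
  · simp [h0]
  rcases hg1 i with h | h
  · simp [h]
  have hs : 0 < ‖a (w j)‖ := norm_pos_iff.2 h0
  rw [show ‖g i‖₊ = 1 from NNReal.eq h, ← NNReal.coe_le_coe]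
  push_cast
  set x := ‖inner ℂ (w j) (v i)‖
  set y := ‖inner ℂ (g i) (a (w j))‖
  set s := ‖a (w j)‖
  have e : (1 ^ 2 * x ^ 2 + y ^ 2 / s ^ 2) / 2 * s - x * y = (x - y / s) ^ 2 * s / 2 := by
    field_simp
    ring
  have : 0 ≤ (x - y / s) ^ 2 * s / 2 := by positivity
  linarith

theorem hasSum_inner_mul (a : H →L[ℂ] H) (w : HilbertBasis κ ℂ H) (x y : H) :
    HasSum (fun j => inner ℂ (w j) x * inner ℂ y (a (w j))) (inner ℂ y (a x)) := by
  simpa [inner_smul_right] using (hasSum_apply a w x).mapL (innerSL ℂ y)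

theorem tsum_diagonalWeight_mul_ne_top (hw : IsSingularBasis a w)
    (hg1 : ∀ i, g i = 0 ∨ ‖g i‖ = 1) (i : ι) :
    ∑' j, (diagonalWeight a v g w i j : ℝ≥0∞) * (‖a (w j)‖₊ : ℝ≥0∞) ≠ ∞ := by
  have : ∑' j, (diagonalWeight a v g w i j : ℝ≥0∞) * (‖a (w j)‖₊ : ℝ≥0∞) ≤
      ∑' j, (diagonalWeight a v g w i j : ℝ≥0∞) * (‖a‖₊ : ℝ≥0∞) := by
    refine ENNReal.tsum_le_tsum fun j => mul_le_mul_right ?_ _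
    have := a.le_opNorm (w j)
    rw [w.orthonormal.1 j, mul_one] at this
    exact_mod_cast this
  refine ne_top_of_le_ne_top ?_ this
  rw [ENNReal.tsum_mul_right]
  exact ENNReal.mul_ne_top
    (ne_top_of_le_ne_top ENNReal.one_ne_top (tsum_diagonalWeight_right_le hw hg1 i))
    ENNReal.coe_ne_top

theorem nnnorm_inner_apply_le (hw : IsSingularBasis a w)
    (hg1 : ∀ i, g i = 0 ∨ ‖g i‖ = 1) (i : ι) :
    (‖inner ℂ (g i) (a (v i))‖₊ : ℝ≥0∞) ≤
      ∑' j, (diagonalWeight a v g w i j : ℝ≥0∞) * (‖a (w j)‖₊ : ℝ≥0∞) := by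
  have hfin := tsum_diagonalWeight_mul_ne_top (v := v) hw hg1 i
  simp only [← ENNReal.coe_mul] at hfin ⊢
  have hs := ENNReal.tsum_coe_ne_top_iff_summable.1 hfin
  rw [← ENNReal.coe_tsum hs, ENNReal.coe_le_coe, ← (hasSum_inner_mul a w (v i) (g i)).tsum_eq]
  have hs' : Summable fun j => ‖inner ℂ (w j) (v i) * inner ℂ (g i) (a (w j))‖₊ :=
    NNReal.summable_of_le (fun j => nnnorm_inner_mul_le hg1 i j) hs
  exact (nnnorm_tsum_le hs').trans (hs'.tsum_le_tsum (fun j => nnnorm_inner_mul_le hg1 i j) hs)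

theorem tsum_diagonal_rpow_le_tsum {p : ℝ} (hp : 1 < p) (hw : IsSingularBasis a w)
    (hg1 : ∀ i, g i = 0 ∨ ‖g i‖ = 1) :
    ∑' i, (‖inner ℂ (g i) (a (v i))‖₊ : ℝ≥0∞) ^ p ≤
      ∑' j, (∑' i, (diagonalWeight a v g w i j : ℝ≥0∞)) * (‖a (w j)‖₊ : ℝ≥0∞) ^ p := by
  simp only [← ENNReal.tsum_mul_right]
  rw [ENNReal.tsum_comm]
  refine ENNReal.tsum_le_tsum fun i => ?_
  refine (ENNReal.rpow_le_rpow (nnnorm_inner_apply_le hw hg1 i) (by linarith)).trans ?_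
  exact (jensen (by linarith) (tsum_diagonalWeight_right_le hw hg1 i)
    (tsum_diagonalWeight_mul_ne_top hw hg1 i)).1 hp

theorem tsum_weight_mul_rpow_le {p : ℝ} (hg : ∀ i k, i ≠ k → inner ℂ (g i) (g k) = 0)
    (hg1 : ∀ i, g i = 0 ∨ ‖g i‖ = 1) (j : κ) :
    (∑' i, (diagonalWeight a v g w i j : ℝ≥0∞)) * (‖a (w j)‖₊ : ℝ≥0∞) ^ p ≤
      (‖a (w j)‖₊ : ℝ≥0∞) ^ p := by
  refine mul_le_of_le_one_left' ?_
  rw [tsum_diagonalWeight_left_eq]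
  exact add_mul_half_le_one (tsum_mul_inner_le hg1 j) (tsum_inner_div_norm_le hg hg1 j)

theorem tsum_diagonal_rpow_le {p : ℝ} (hp : 1 < p) (hw : IsSingularBasis a w)
    (hg : ∀ i k, i ≠ k → inner ℂ (g i) (g k) = 0) (hg1 : ∀ i, g i = 0 ∨ ‖g i‖ = 1) :
    ∑' i, (‖inner ℂ (g i) (a (v i))‖₊ : ℝ≥0∞) ^ p ≤ ∑' j, (‖a (w j)‖₊ : ℝ≥0∞) ^ p :=
  (tsum_diagonal_rpow_le_tsum hp hw hg1).trans
    (ENNReal.tsum_le_tsum fun j => tsum_weight_mul_rpow_le hg hg1 j)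

theorem eq_one_of_add_mul_half {x y : ℝ≥0∞} (hx : x ≤ 1) (hy : y ≤ 1)
    (h : (x + y) * 2⁻¹ = 1) : x = 1 ∧ y = 1 := by
  have h' : x + y = 1 + 1 := by
    rw [one_add_one_eq_two, ← one_mul (2 : ℝ≥0∞), ← h, mul_assoc,
      ENNReal.inv_mul_cancel two_ne_zero ENNReal.ofNat_ne_top, mul_one]
  exact PowLE.eq_of_add_eq (q := 2) (by norm_num) ⟨fun _ => hx, fun h => by norm_num at h⟩
    ⟨fun _ => hy, fun h => by norm_num at h⟩ h' (by rw [h']; norm_num)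

theorem apply_eq_of_tsum_diagonal_rpow_eq {p : ℝ} (hp : 1 < p) (hw : IsSingularBasis a w)
    (hg : ∀ i k, i ≠ k → inner ℂ (g i) (g k) = 0) (hg1 : ∀ i, g i = 0 ∨ ‖g i‖ = 1)
    (heq : ∑' i, (‖inner ℂ (g i) (a (v i))‖₊ : ℝ≥0∞) ^ p = ∑' j, (‖a (w j)‖₊ : ℝ≥0∞) ^ p)
    (hfin : ∑' j, (‖a (w j)‖₊ : ℝ≥0∞) ^ p ≠ ∞) (i : ι) :
    a (v i) = inner ℂ (g i) (a (v i)) • g i := by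
  have hp0 : 0 < p := by linarith
  have h1 := tsum_diagonal_rpow_le_tsum (v := v) hp hw hg1
  have h2 := ENNReal.tsum_le_tsum fun j =>
    tsum_weight_mul_rpow_le (p := p) (v := v) (w := w) (a := a) hg hg1 j
  have h3 := le_antisymm h2 (heq ▸ h1)
  have h4 := heq.trans h3.symm
  have hC : ∀ j, a (w j) ≠ 0 → ∑' i, (diagonalWeight a v g w i j : ℝ≥0∞) = 1 := by
    intro j hj
    have := eq_of_tsum_eq_of_le
      (fun j => tsum_weight_mul_rpow_le (p := p) (v := v) (w := w) (a := a) hg hg1 j)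
      h3 (h3 ▸ hfin) j
    have hne : (‖a (w j)‖₊ : ℝ≥0∞) ^ p ≠ 0 := by
      rw [Ne, ENNReal.rpow_eq_zero_iff_of_pos hp0]
      simpa using hj
    rw [← ENNReal.mul_left_inj hne (ENNReal.rpow_ne_top_of_nonneg hp0.le ENNReal.coe_ne_top),
      this, one_mul]
  rcases hg1 i with h | h
  · have h0 : ∀ j, inner ℂ (w j) (v i) • a (w j) = 0 := by
      intro j
      by_cases hj : a (w j) = 0
      · rw [hj, smul_zero]
      · have hc := hC j hj
        rw [tsum_diagonalWeight_left_eq] at hc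
        have hc' := (eq_one_of_add_mul_half (tsum_mul_inner_le hg1 j)
          (tsum_inner_div_norm_le hg hg1 j) hc).1
        have hone : ∑' i, ((‖inner ℂ (w j) (v i)‖₊ ^ 2 : ℝ≥0) : ℝ≥0∞) = 1 := by
          simp only [nnnorm_inner_comm (w j)]
          rw [tsum_nnnorm_inner_sq, show ‖w j‖₊ = 1 from NNReal.eq (w.orthonormal.1 j)]
          simp
        have := eq_of_tsum_eq_of_le (fun i => mul_le_of_le_one_left'
          (by exact_mod_cast nnnorm_le_one_of_eq_zero_or hg1)) (hc'.trans hone.symm)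
          (by rw [hc']; exact ENNReal.one_ne_top) i
        have hz : inner ℂ (w j) (v i) = 0 := by simpa [h] using this.symm
        rw [hz, zero_smul]
    have := hasSum_apply a w (v i)
    simp only [h0] at this
    rw [this.unique hasSum_zero, h, smul_zero]
  · have hα := nnnorm_inner_apply_le (v := v) hw hg1
    have hJ := fun i => (jensen hp0 (tsum_diagonalWeight_right_le (v := v) hw hg1 i)
      (tsum_diagonalWeight_mul_ne_top hw hg1 i)).1 hp
    simp only [← ENNReal.tsum_mul_right] at h4
    rw [ENNReal.tsum_comm] at h4
    have h5 := eq_of_tsum_eq_of_le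
      (fun i => (ENNReal.rpow_le_rpow (hα i) hp0.le).trans (hJ i)) h4 (heq ▸ hfin) i
    have h6 := le_antisymm (hJ i) (h5 ▸ ENNReal.rpow_le_rpow (hα i) hp0.le)
    have h7 : (‖inner ℂ (g i) (a (v i))‖₊ : ℝ≥0∞) =
        ∑' j, (diagonalWeight a v g w i j : ℝ≥0∞) * (‖a (w j)‖₊ : ℝ≥0∞) :=
      ENNReal.rpow_left_injective hp0.ne' (h5.trans h6.symm)
    have h8 : ∀ j, inner ℂ (w j) (v i) ≠ 0 → ‖a (w j)‖₊ = ‖inner ℂ (g i) (a (v i))‖₊ := by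
      intro j hj
      have hne : diagonalWeight a v g w i j ≠ 0 := by
        have : 0 < ‖inner ℂ (w j) (v i)‖₊ := nnnorm_pos.2 hj
        rw [diagonalWeight, show ‖g i‖₊ = 1 from NNReal.eq h]
        positivity
      have := jensen_eq hp0 hp.ne' (t := fun j => ‖a (w j)‖₊)
        (tsum_diagonalWeight_right_le hw hg1 i)
        (tsum_diagonalWeight_mul_ne_top hw hg1 i) h6 hne
      rw [← h7] at this
      exact_mod_cast this
    have h9 : ((‖a (v i)‖₊ ^ 2 : ℝ≥0) : ℝ≥0∞) =
        ((‖inner ℂ (g i) (a (v i))‖₊ ^ 2 : ℝ≥0) : ℝ≥0∞) := by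
      rw [← hw.tsum_nnnorm_sq]
      have : ∀ j, ((‖inner ℂ (w j) (v i)‖₊ ^ 2 : ℝ≥0) : ℝ≥0∞) *
          ((‖a (w j)‖₊ ^ 2 : ℝ≥0) : ℝ≥0∞) = ((‖inner ℂ (w j) (v i)‖₊ ^ 2 : ℝ≥0) : ℝ≥0∞) *
          ((‖inner ℂ (g i) (a (v i))‖₊ ^ 2 : ℝ≥0) : ℝ≥0∞) := by
        intro j
        by_cases hj : inner ℂ (w j) (v i) = 0
        · simp [hj]
        · rw [h8 j hj]
      rw [tsum_congr this, ENNReal.tsum_mul_right, tsum_nnnorm_inner_sq,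
        show ‖v i‖₊ = 1 from NNReal.eq (v.orthonormal.1 i)]
      simp
    have h10 : ‖a (v i)‖ ^ 2 = ‖inner ℂ (g i) (a (v i))‖ ^ 2 := by
      have := ENNReal.coe_inj.1 h9
      simpa only [NNReal.coe_pow, coe_nnnorm] using congrArg NNReal.toReal this
    have h13 : ‖a (v i) - inner ℂ (g i) (a (v i)) • g i‖ ^ 2 = 0 := by
      rw [@norm_sub_sq ℂ, inner_smul_right, norm_smul, h, ← inner_conj_symm (a (v i)),
        RCLike.mul_conj, h10]
      norm_cast
      ring
    exact sub_eq_zero.1 (norm_eq_zero.1 (pow_eq_zero_iff two_ne_zero |>.1 h13))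

end Diagonal

theorem eq_of_schattenNorm_add_eq {H : Type u} [NormedAddCommGroup H] [InnerProductSpace ℂ H]
    [CompleteSpace H] {p : ℝ} (hp : 1 < p) {a b : H →L[ℂ] H} (ha : IsCompactOperator a)
    (hb : IsCompactOperator b) (ha1 : schattenNorm p a ^ p = 1) (hb1 : schattenNorm p b ^ p = 1)
    (hab : schattenNorm p (a + b) ^ p = 2 ^ p) : a = b := by
  have hp0 : 0 < p := by linarith
  have hx : IsCompactOperator (a + b) := ha.add hb
  obtain ⟨ι, v, hv⟩ := exists_isSingularBasis hx
  obtain ⟨κ, w, hw⟩ := exists_isSingularBasis ha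
  obtain ⟨κ', w', hw'⟩ := exists_isSingularBasis hb
  rw [schattenNorm_rpow_eq hp0 hx hv, powSum_half] at hab
  rw [schattenNorm_rpow_eq hp0 ha hw, powSum_half] at ha1
  rw [schattenNorm_rpow_eq hp0 hb hw', powSum_half] at hb1
  let g : ι → H := fun i => ((‖(a + b) (v i)‖⁻¹ : ℝ) : ℂ) • (a + b) (v i)
  have hg : ∀ i k, i ≠ k → inner ℂ (g i) (g k) = 0 := fun i k hik => by
    rw [inner_smul_left, inner_smul_right, hv i k hik, mul_zero, mul_zero]
  have hg1 : ∀ i, g i = 0 ∨ ‖g i‖ = 1 := by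
    intro i
    by_cases h0 : (a + b) (v i) = 0
    · left
      simp only [g, h0, smul_zero]
    · right
      have := norm_ne_zero_iff.2 h0
      simp only [g, norm_smul, Complex.norm_real, norm_inv, norm_norm]
      exact inv_mul_cancel₀ this
  let α : ι → ℂ := fun i => inner ℂ (g i) (a (v i))
  let β : ι → ℂ := fun i => inner ℂ (g i) (b (v i))
  have hr : ∀ i, α i + β i = (‖(a + b) (v i)‖ : ℂ) := by
    intro i
    rw [← inner_add_right, ← add_apply]
    simp only [g, inner_smul_left, Complex.conj_ofReal, inner_self_eq_norm_sq_to_K]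
    generalize ‖(a + b) (v i)‖ = r
    by_cases h0 : r = 0
    · simp [h0]
    · push_cast
      rw [pow_two, ← mul_assoc]
      exact (congrArg (· * _) (inv_mul_cancel₀ (by exact_mod_cast h0))).trans (one_mul _)
  have hrn : ∀ i, ‖(a + b) (v i)‖ = ‖α i + β i‖ := fun i => by
    rw [hr i, Complex.norm_real, norm_norm]
  have hA := tsum_diagonal_rpow_le (v := v) hp hw hg hg1
  have hB := tsum_diagonal_rpow_le (v := v) hp hw' hg hg1
  rw [ha1] at hA
  rw [hb1] at hB
  have hle1 : ∀ i, 2 * ((‖(a + b) (v i)‖₊ / 2 : ℝ≥0) : ℝ≥0∞) ^ p ≤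
      2 * (((‖α i‖₊ + ‖β i‖₊) / 2 : ℝ≥0) : ℝ≥0∞) ^ p := by
    intro i
    refine mul_le_mul_right (ENNReal.rpow_le_rpow (ENNReal.coe_le_coe.2 ?_) hp0.le) _
    rw [show ‖(a + b) (v i)‖₊ = ‖α i + β i‖₊ from NNReal.eq (hrn i)]
    gcongr
    exact nnnorm_add_le _ _
  have hle2 := fun i => two_mul_add_div_two_rpow_le hp ‖α i‖₊ ‖β i‖₊
  have hsum1 : ∑' i, 2 * ((‖(a + b) (v i)‖₊ / 2 : ℝ≥0) : ℝ≥0∞) ^ p = 1 + 1 := by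
    have : ∀ i, 2 * ((‖(a + b) (v i)‖₊ / 2 : ℝ≥0) : ℝ≥0∞) ^ p =
        2 * ((‖(a + b) (v i)‖₊ : ℝ≥0∞) ^ p * (2 ^ p)⁻¹) := by
      intro i
      rw [ENNReal.coe_div two_ne_zero, ENNReal.div_rpow_of_nonneg _ _ hp0.le, div_eq_mul_inv]
      rfl
    rw [tsum_congr this, ENNReal.tsum_mul_left, ENNReal.tsum_mul_right, hab,
      ENNReal.mul_inv_cancel, mul_one, one_add_one_eq_two]
    · rw [Ne, ENNReal.rpow_eq_zero_iff_of_pos hp0]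
      norm_num
    · exact ENNReal.rpow_ne_top_of_nonneg hp0.le ENNReal.ofNat_ne_top
  have hge : ∑' i, 2 * ((‖(a + b) (v i)‖₊ / 2 : ℝ≥0) : ℝ≥0∞) ^ p ≤
      ∑' i, ((‖α i‖₊ : ℝ≥0∞) ^ p + (‖β i‖₊ : ℝ≥0∞) ^ p) :=
    ENNReal.tsum_le_tsum fun i => (hle1 i).trans (hle2 i)
  have hsum2 : ∑' i, 2 * ((‖(a + b) (v i)‖₊ / 2 : ℝ≥0) : ℝ≥0∞) ^ p =
      ∑' i, ((‖α i‖₊ : ℝ≥0∞) ^ p + (‖β i‖₊ : ℝ≥0∞) ^ p) := by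
    refine le_antisymm hge ?_
    rw [ENNReal.tsum_add, hsum1]
    exact add_le_add hA hB
  have hfin : ∑' i, 2 * ((‖(a + b) (v i)‖₊ / 2 : ℝ≥0) : ℝ≥0∞) ^ p ≠ ∞ := by
    rw [hsum1]
    norm_num
  have hAB : ∑' i, (‖α i‖₊ : ℝ≥0∞) ^ p = 1 ∧ ∑' i, (‖β i‖₊ : ℝ≥0∞) ^ p = 1 := by
    have h' := hsum2.symm.trans hsum1
    rw [ENNReal.tsum_add] at h'
    exact PowLE.eq_of_add_eq (q := 2) (by norm_num) ⟨fun _ => hA, fun h => by norm_num at h⟩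
      ⟨fun _ => hB, fun h => by norm_num at h⟩ h' (by rw [h']; norm_num)
  have hav := apply_eq_of_tsum_diagonal_rpow_eq (v := v) hp hw hg hg1 (hAB.1.trans ha1.symm)
    (by rw [ha1]; norm_num)
  have hbv := apply_eq_of_tsum_diagonal_rpow_eq (v := v) hp hw' hg hg1 (hAB.2.trans hb1.symm)
    (by rw [hb1]; norm_num)
  have hαβ : ∀ i, α i = β i := by
    intro i
    have h1 := eq_of_tsum_eq_of_le (fun i => (hle1 i).trans (hle2 i)) hsum2 hfin i
    have h2 := le_antisymm (hle2 i) (h1 ▸ hle1 i)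
    have h3 : ‖α i‖ = ‖β i‖ :=
      congrArg NNReal.toReal (eq_of_two_mul_add_div_two_rpow_eq hp h2)
    have h4 : ‖(a + b) (v i)‖ = ‖α i‖ + ‖β i‖ := by
      have h5 := h1.trans h2.symm
      rw [ENNReal.mul_right_inj two_ne_zero ENNReal.ofNat_ne_top] at h5
      have h6 := ENNReal.coe_inj.1 (ENNReal.rpow_left_injective hp0.ne' h5)
      have h7 : ‖(a + b) (v i)‖ / 2 = (‖α i‖ + ‖β i‖) / 2 := congrArg NNReal.toReal h6
      linarith
    have h5 := parallelogram_law_with_norm ℂ (α i) (β i)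
    rw [← hrn, h4, h3] at h5
    have h6 : ‖α i - β i‖ ^ 2 = 0 := by nlinarith
    exact sub_eq_zero.1 (norm_eq_zero.1 (pow_eq_zero_iff two_ne_zero |>.1 h6))
  ext x
  have h1 := hasSum_apply a v x
  have h2 := hasSum_apply b v x
  have h3 : ∀ i, a (v i) = b (v i) := fun i => by
    rw [hav i, hbv i]
    exact congrArg (· • g i) (hαβ i)
  simp only [h3] at h1
  exact h1.unique h2

open InnerProductSpace

theorem exists_unit_orthogonal {H : Type*} [NormedAddCommGroup H] [InnerProductSpace ℂ H]
    {η ξ x : H} (hη : ‖η‖ = 1) (hξ : ‖ξ‖ = 1)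
    (hx : inner ℂ ξ x = 0) (hx0 : x ≠ 0) : ∃ y : H, ‖y‖ = 1 ∧ inner ℂ η y = 0 := by
  have hη0 : η ≠ 0 := fun h => by simp [h] at hη
  have hξ0 : ξ ≠ 0 := fun h => by simp [h] at hξ
  have key : ∃ y : H, y ≠ 0 ∧ inner ℂ η y = 0 := by
    by_contra! hall
    have hz : ∀ z : H, z = inner ℂ η z • η := by
      intro z
      by_contra hne
      refine hall (z - inner ℂ η z • η) (sub_ne_zero.2 hne) ?_
      rw [inner_sub_right, inner_smul_right, inner_self_eq_norm_sq_to_K, hη]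
      simp
    rw [hz ξ, hz x, inner_smul_left, inner_smul_right, inner_self_eq_norm_sq_to_K, hη] at hx
    simp only [RCLike.ofReal_one, one_pow, mul_one, mul_eq_zero, map_eq_zero] at hx
    rcases hx with h | h
    · exact hξ0 (by rw [hz ξ, h, zero_smul])
    · exact hx0 (by rw [hz x, h, zero_smul])
  obtain ⟨y, hy0, hy⟩ := key
  refine ⟨((‖y‖⁻¹ : ℝ) : ℂ) • y, ?_, ?_⟩
  · simp [norm_smul, norm_ne_zero_iff.2 hy0]
  · rw [inner_smul_right, hy, mul_zero]

section Sphere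

variable {H : Type u} [NormedAddCommGroup H] [InnerProductSpace ℂ H] [CompleteSpace H] {p : ℝ}

theorem schattenNorm_smul_rpow (hp : 0 < p) {a : H →L[ℂ] H} (ha : IsCompactOperator a) (c : ℂ) :
    schattenNorm p (c • a) ^ p = (‖c‖₊ : ℝ≥0∞) ^ p * schattenNorm p a ^ p := by
  obtain ⟨ι, f, hf⟩ := exists_isSingularBasis ha
  have hca : IsCompactOperator (c • a) := ha.smul c
  have hf' : IsSingularBasis (c • a) f := fun i k hik => by
    simp [hf i k hik]
  rw [schattenNorm_rpow_eq hp ha hf, schattenNorm_rpow_eq hp hca hf', powSum_half, powSum_half,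
    ← ENNReal.tsum_mul_left]
  refine tsum_congr fun i => ?_
  rw [smul_apply, nnnorm_smul, ENNReal.coe_mul, ENNReal.mul_rpow_of_nonneg _ _ hp.le]

theorem schattenNorm_rpow_of_mem {a : H →L[ℂ] H} (ha : a ∈ schattenSphere p H) :
    schattenNorm p a ^ p = 1 := by
  rw [ha.2, ENNReal.one_rpow]

theorem mem_schattenSphere_of_rpow (hp : 0 < p) {a : H →L[ℂ] H} (ha : IsCompactOperator a)
    (h : schattenNorm p a ^ p = 1) : a ∈ schattenSphere p H := by
  have h1 : schattenNorm p a = 1 :=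
    ENNReal.rpow_left_injective hp.ne' (h.trans (ENNReal.one_rpow p).symm)
  exact ⟨⟨ha, by rw [h1]; exact ENNReal.one_lt_top⟩, h1⟩

theorem schattenNorm_smul_rpow_of_mem (hp : 0 < p) {a : H →L[ℂ] H}
    (ha : a ∈ schattenSphere p H) (c : ℂ) :
    schattenNorm p (c • a) ^ p = (‖c‖₊ : ℝ≥0∞) ^ p := by
  rw [schattenNorm_smul_rpow hp ha.1.1, schattenNorm_rpow_of_mem ha, mul_one]

theorem smul_mem_schattenSphere (hp : 0 < p) {a : H →L[ℂ] H} (ha : a ∈ schattenSphere p H)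
    {c : ℂ} (hc : ‖c‖ = 1) : c • a ∈ schattenSphere p H := by
  refine mem_schattenSphere_of_rpow hp (ha.1.1.smul c) ?_
  rw [schattenNorm_smul_rpow_of_mem hp ha, show ‖c‖₊ = 1 from NNReal.eq hc]
  simp

theorem norm_eq_one_of_smul_mem (hp : 0 < p) {a : H →L[ℂ] H} (ha : a ∈ schattenSphere p H)
    {c : ℂ} (hc : c • a ∈ schattenSphere p H) : ‖c‖ = 1 := by
  have h1 := schattenNorm_smul_rpow_of_mem hp ha c
  rw [schattenNorm_rpow_of_mem hc, ← ENNReal.one_rpow p] at h1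
  have h2 := ENNReal.rpow_left_injective hp.ne' h1
  exact congrArg NNReal.toReal (ENNReal.coe_eq_one.1 h2.symm)

theorem neg_mem_schattenSphere (hp : 0 < p) {a : H →L[ℂ] H} (ha : a ∈ schattenSphere p H) :
    -a ∈ schattenSphere p H := by
  simpa using smul_mem_schattenSphere hp ha (c := -1) (by simp)

theorem ne_zero_of_mem (hp : 0 < p) {a : H →L[ℂ] H} (ha : a ∈ schattenSphere p H) : a ≠ 0 := by
  rintro rfl
  have := norm_eq_one_of_smul_mem hp ha (c := 0) (by simpa using ha)
  simp at this

theorem orth_iff_of_mem (hp : 0 < p) (hp2 : p ≠ 2) {a b : H →L[ℂ] H}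
    (ha : a ∈ schattenSphere p H) (hb : b ∈ schattenSphere p H) :
    Orth a b ↔ schattenNorm p (a + b) ^ p + schattenNorm p (a - b) ^ p = 4 := by
  have h1 := schattenNorm_rpow_of_mem ha
  have h2 := schattenNorm_rpow_of_mem hb
  constructor
  · intro h
    rw [sub_eq_add_neg, h.schattenNorm_add hp hp2 ha.1.1 hb.1.1,
      h.neg_right.schattenNorm_add hp hp2 ha.1.1 (neg_mem_schattenSphere hp hb).1.1,
      schattenNorm_rpow_of_mem (neg_mem_schattenSphere hp hb), h1, h2]
    norm_num
  · intro h
    refine orth_of_clarkson_eq hp hp2 ha.1.1 hb.1.1 (by rw [h1]; norm_num)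
      (by rw [h2]; norm_num) ?_
    rw [h, h1, h2]
    norm_num

theorem orth_smul_left_iff {a b : H →L[ℂ] H} {c : ℂ} (hc : c ≠ 0) : Orth (c • a) b ↔ Orth a b := by
  unfold Orth
  rw [map_smulₛₗ, comp_smulₛₗ, comp_smul, smul_eq_zero, smul_eq_zero]
  simp [hc]

theorem orth_rankOne_iff {η ξ : H} (hη : ‖η‖ = 1) (hξ : ‖ξ‖ = 1) {c : H →L[ℂ] H} :
    Orth (rankOne ℂ η ξ) c ↔ c ξ = 0 ∧ adjoint c η = 0 := by
  have hη0 : η ≠ 0 := fun h => by simp [h] at hη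
  have hξ0 : ξ ≠ 0 := fun h => by simp [h] at hξ
  unfold Orth
  rw [adjoint_rankOne, comp_rankOne, comp_rankOne, rankOne_eq_zero, rankOne_eq_zero]
  simp [hη0, hξ0]

theorem rankOne_mem_schattenSphere (hp : 0 < p) {η ξ : H} (hη : ‖η‖ = 1) (hξ : ‖ξ‖ = 1) :
    rankOne ℂ η ξ ∈ schattenSphere p H := by
  have hc : IsCompactOperator (rankOne ℂ η ξ) :=
    (isCompactOperator_of_locallyCompactSpace_dom (innerSL ℂ ξ)).clm_comp (toSpanSingleton ℂ η)
  refine mem_schattenSphere_of_rpow hp hc ?_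
  have hs : Orthonormal ℂ ((↑) : ({ξ} : Set H) → H) := by
    refine ⟨fun i => ?_, fun i k hik => absurd (Subsingleton.elim i k) hik⟩
    rw [show (i : H) = ξ from i.2, hξ]
  obtain ⟨w, b, hw, hb⟩ := hs.exists_hilbertBasis_extension
  let i₀ : w := ⟨ξ, hw rfl⟩
  have hi₀ : b i₀ = ξ := by rw [hb]
  have hz : ∀ i, i ≠ i₀ → rankOne ℂ η ξ (b i) = 0 := by
    intro i hi
    rw [rankOne_apply, ← hi₀, b.orthonormal.2 hi.symm, zero_smul]
  have hf : IsSingularBasis (rankOne ℂ η ξ) b := by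
    intro i k hik
    by_cases hi : i = i₀
    · rw [hz k (fun h => hik (hi.trans h.symm)), inner_zero_right]
    · rw [hz i hi, inner_zero_left]
  rw [schattenNorm_rpow_eq hp hc hf, powSum_half, tsum_eq_single i₀]
  · rw [hi₀, rankOne_apply, inner_self_eq_norm_sq_to_K, hξ, nnnorm_smul,
      show ‖η‖₊ = 1 from NNReal.eq hη]
    simp
  · intro i hi
    rw [hz i hi]
    simp [ENNReal.zero_rpow_of_pos hp]

theorem mem_minimalPartialIsometries_iff {e : H →L[ℂ] H} :
    e ∈ minimalPartialIsometries H ↔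
      ∃ η ξ : H, ‖η‖ = 1 ∧ ‖ξ‖ = 1 ∧ e = rankOne ℂ η ξ := by
  constructor
  · rintro ⟨he, hr⟩
    obtain ⟨⟨y, hy⟩, hy0, hspan⟩ := finrank_eq_one_iff'.1 hr
    have hy0' : y ≠ 0 := fun h => hy0 (Subtype.ext h)
    have hn : ‖y‖ ≠ 0 := norm_ne_zero_iff.2 hy0'
    let η : H := ((‖y‖⁻¹ : ℝ) : ℂ) • y
    have hη : ‖η‖ = 1 := by simp [η, norm_smul, hn]
    have he1 : ∀ x, ∃ t : ℂ, e x = t • η := by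
      intro x
      obtain ⟨t, ht⟩ := hspan ⟨e x, ⟨x, rfl⟩⟩
      refine ⟨t * ‖y‖, ?_⟩
      have h1 : t • y = e x := congrArg Subtype.val ht
      have h2 : (‖y‖ : ℂ) ≠ 0 := by exact_mod_cast hn
      rw [← h1, smul_smul, Complex.ofReal_inv, mul_assoc, mul_inv_cancel₀ h2, mul_one]
    let ξ := adjoint e η
    have he2 : e = rankOne ℂ η ξ := by
      ext x
      obtain ⟨t, ht⟩ := he1 x
      rw [rankOne_apply, adjoint_inner_left, ht, inner_smul_right, inner_self_eq_norm_sq_to_K, hη]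
      simp
    refine ⟨η, ξ, hη, ?_, he2⟩
    have hη0 : η ≠ 0 := fun h => by simp [h] at hη
    have hξ0 : ξ ≠ 0 := by
      intro h
      rw [h, map_zero] at he2
      have : y ∈ LinearMap.range (e : H →ₗ[ℂ] H) := hy
      rw [he2] at this
      obtain ⟨x, hx⟩ := this
      exact hy0' (hx.symm.trans (by simp))
    have h3 := congrArg (fun T : H →L[ℂ] H => T ξ) he
    change e (adjoint e (e ξ)) = e ξ at h3
    have h4 : e ξ = ((‖ξ‖ ^ 2 : ℝ) : ℂ) • η := by
      conv_lhs => rw [he2]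
      rw [rankOne_apply, inner_self_eq_norm_sq_to_K]
      norm_cast
    have h5 : adjoint e η = ξ := rfl
    rw [h4, map_smul, h5, map_smul, h4, smul_smul] at h3
    have h6 := smul_left_injective ℂ hη0 h3
    have h7 : ‖ξ‖ ^ 2 * ‖ξ‖ ^ 2 = ‖ξ‖ ^ 2 := by exact_mod_cast h6
    have h8 : ‖ξ‖ ^ 2 = 1 := mul_left_cancel₀ (pow_ne_zero 2 (norm_ne_zero_iff.2 hξ0))
      (h7.trans (mul_one _).symm)
    exact (pow_eq_one_iff_of_nonneg (norm_nonneg _) two_ne_zero).1 h8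
  · rintro ⟨η, ξ, hη, hξ, rfl⟩
    have hη0 : η ≠ 0 := fun h => by simp [h] at hη
    have hξ0 : ξ ≠ 0 := fun h => by simp [h] at hξ
    refine ⟨?_, ?_⟩
    · ext x
      simp [star_eq_adjoint, inner_self_eq_norm_sq_to_K, hη, hξ]
    · rw [← Module.rank_eq_one_iff_finrank_eq_one]
      exact rank_rankOne hη0 hξ0

theorem minimalPartialIsometries_subset (hp : 0 < p) :
    minimalPartialIsometries H ⊆ schattenSphere p H := by
  intro e he
  obtain ⟨η, ξ, hη, hξ, rfl⟩ := mem_minimalPartialIsometries_iff.1 he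
  exact rankOne_mem_schattenSphere hp hη hξ

theorem apply_eq_zero_of_orth_imp (hp : 0 < p) {η ξ : H} (hη : ‖η‖ = 1) (hξ : ‖ξ‖ = 1)
    {b : H →L[ℂ] H}
    (h : ∀ c ∈ schattenSphere p H, Orth (rankOne ℂ η ξ) c → Orth b c) :
    (∀ x, inner ℂ ξ x = 0 → b x = 0) ∧ ∀ y, inner ℂ η y = 0 → adjoint b y = 0 := by
  have key : ∀ x y : H, ‖x‖ = 1 → ‖y‖ = 1 → inner ℂ ξ x = 0 → inner ℂ η y = 0 →
      b x = 0 ∧ adjoint b y = 0 := by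
    intro x y hx hy hξx hηy
    refine (orth_rankOne_iff hy hx).1
      (h _ (rankOne_mem_schattenSphere hp hy hx) ((orth_rankOne_iff hη hξ).2 ⟨?_, ?_⟩)).symm
    · rw [rankOne_apply, inner_eq_zero_symm.1 hξx, zero_smul]
    · rw [adjoint_rankOne, rankOne_apply, inner_eq_zero_symm.1 hηy, zero_smul]
  have hnorm : ∀ x : H, x ≠ 0 → ‖((‖x‖⁻¹ : ℝ) : ℂ) • x‖ = 1 := fun x hx => by
    simp [norm_smul, norm_ne_zero_iff.2 hx]
  have hcoe : ∀ x : H, x ≠ 0 → ((‖x‖⁻¹ : ℝ) : ℂ) ≠ 0 := fun x hx => by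
    simpa using hx
  constructor
  · intro x hx
    by_contra hbx
    have hx0 : x ≠ 0 := fun h0 => hbx (by rw [h0, map_zero])
    obtain ⟨y, hy, hηy⟩ := exists_unit_orthogonal hη hξ hx hx0
    have := (key _ y (hnorm x hx0) hy (by rw [inner_smul_right, hx, mul_zero]) hηy).1
    rw [map_smul, smul_eq_zero] at this
    exact hbx (this.resolve_left (hcoe x hx0))
  · intro y hy
    by_contra hby
    have hy0 : y ≠ 0 := fun h0 => hby (by rw [h0, map_zero])
    obtain ⟨x, hx, hξx⟩ := exists_unit_orthogonal hξ hη hy hy0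
    have := (key x _ hx (hnorm y hy0) hξx (by rw [inner_smul_right, hy, mul_zero])).2
    rw [map_smul, smul_eq_zero] at this
    exact hby (this.resolve_left (hcoe y hy0))

theorem eq_smul_rankOne {η ξ : H} (hη : ‖η‖ = 1) (hξ : ‖ξ‖ = 1) {b : H →L[ℂ] H}
    (h1 : ∀ x, inner ℂ ξ x = 0 → b x = 0) (h2 : ∀ y, inner ℂ η y = 0 → adjoint b y = 0) :
    b = inner ℂ η (b ξ) • rankOne ℂ η ξ := by
  have h3 : ∀ z, b z = inner ℂ ξ z • b ξ := by
    intro z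
    have := h1 (z - inner ℂ ξ z • ξ) (by
      rw [inner_sub_right, inner_smul_right, inner_self_eq_norm_sq_to_K, hξ]
      simp)
    rwa [map_sub, map_smul, sub_eq_zero] at this
  have h4 : b ξ = inner ℂ η (b ξ) • η := by
    set w := b ξ - inner ℂ η (b ξ) • η with hw
    have hηw : inner ℂ η w = 0 := by
      rw [hw, inner_sub_right, inner_smul_right, inner_self_eq_norm_sq_to_K, hη]
      simp
    have h5 : inner ℂ w w = (0 : ℂ) := by
      nth_rw 2 [hw]
      rw [inner_sub_right, inner_smul_right, inner_eq_zero_symm.1 hηw,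
        ← adjoint_inner_left, h2 w hηw, inner_zero_left, mul_zero, sub_zero]
    exact sub_eq_zero.1 (inner_self_eq_zero.1 h5)
  ext z
  rw [h3 z, smul_apply, rankOne_apply, smul_comm, ← h4]

theorem eq_smul_of_orth_imp (hp : 0 < p) {e b : H →L[ℂ] H}
    (he : e ∈ minimalPartialIsometries H) (hb : b ∈ schattenSphere p H)
    (h : ∀ c ∈ schattenSphere p H, Orth e c → Orth b c) : ∃ z : ℂ, ‖z‖ = 1 ∧ b = z • e := by
  obtain ⟨η, ξ, hη, hξ, rfl⟩ := mem_minimalPartialIsometries_iff.1 he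
  obtain ⟨h1, h2⟩ := apply_eq_zero_of_orth_imp hp hη hξ h
  have h3 := eq_smul_rankOne hη hξ h1 h2
  exact ⟨_, norm_eq_one_of_smul_mem hp (rankOne_mem_schattenSphere hp hη hξ) (h3 ▸ hb), h3⟩

theorem exists_minimal_orth_imp {a : H →L[ℂ] H} (ha : IsCompactOperator a) (ha0 : a ≠ 0) :
    ∃ e ∈ minimalPartialIsometries H, ∀ c, Orth a c → Orth e c := by
  obtain ⟨ι, v, hv⟩ := exists_isSingularBasis ha
  obtain ⟨i, hi⟩ : ∃ i, a (v i) ≠ 0 := by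
    by_contra! hall
    refine ha0 (ContinuousLinearMap.ext fun x => ?_)
    have := hasSum_apply a v x
    simp only [hall, smul_zero] at this
    exact this.unique hasSum_zero
  have hn : ‖a (v i)‖ ≠ 0 := norm_ne_zero_iff.2 hi
  have hη : ‖((‖a (v i)‖⁻¹ : ℝ) : ℂ) • a (v i)‖ = 1 := by simp [norm_smul, hn]
  refine ⟨_, mem_minimalPartialIsometries_iff.2 ⟨_, v i, hη, v.orthonormal.1 i, rfl⟩,
    fun c hc => (orth_rankOne_iff hη (v.orthonormal.1 i)).2 ⟨?_, ?_⟩⟩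
  · have h1 : c (adjoint a (a (v i))) = 0 := by
      rw [← comp_apply, hc.1, zero_apply]
    rw [hv.adjoint_apply_apply, map_smul, smul_eq_zero] at h1
    refine h1.resolve_left ?_
    exact_mod_cast pow_ne_zero 2 hn
  · rw [map_smul, ← comp_apply, hc.2, zero_apply, smul_zero]

theorem mem_minimalPartialIsometries_iff_orth (hp : 0 < p) {a : H →L[ℂ] H}
    (ha : a ∈ schattenSphere p H) :
    a ∈ minimalPartialIsometries H ↔ ∀ b ∈ schattenSphere p H,
      (∀ c ∈ schattenSphere p H, Orth a c → Orth b c) →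
        ∀ c ∈ schattenSphere p H, Orth b c → Orth a c := by
  constructor
  · intro he b hb h c _ hbc
    obtain ⟨z, hz, rfl⟩ := eq_smul_of_orth_imp hp he hb h
    exact (orth_smul_left_iff (fun h0 => by simp [h0] at hz)).1 hbc
  · intro h
    obtain ⟨e, he, hae⟩ := exists_minimal_orth_imp ha.1.1 (ne_zero_of_mem hp ha)
    have h1 := h e (minimalPartialIsometries_subset hp he) fun c _ => hae c
    obtain ⟨z, hz, rfl⟩ := eq_smul_of_orth_imp hp he ha h1
    obtain ⟨η, ξ, hη, hξ, rfl⟩ := mem_minimalPartialIsometries_iff.1 he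
    refine mem_minimalPartialIsometries_iff.2 ⟨z • η, ξ, by rw [norm_smul, hz, hη, one_mul], hξ, ?_⟩
    ext x
    simp [smul_comm z]

end Sphere

theorem circle_isometry {f : ℂ → ℂ} (h1 : f 1 = 1) (hf : ∀ c, ‖c‖ = 1 → ‖f c‖ = 1)
    (hiso : ∀ c d, ‖c‖ = 1 → ‖d‖ = 1 → ‖f c - f d‖ = ‖c - d‖) :
    (∀ c, ‖c‖ = 1 → f c = c) ∨ ∀ c, ‖c‖ = 1 → f c = (starRingEnd ℂ) c := by
  have hsq : ∀ z : ℂ, ‖z‖ ^ 2 = z.re ^ 2 + z.im ^ 2 := fun z => by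
    rw [← Complex.normSq_eq_norm_sq, Complex.normSq_apply]
    ring
  have hprod : ∀ c d, ‖c‖ = 1 → ‖d‖ = 1 →
      (f c).re * (f d).re + (f c).im * (f d).im = c.re * d.re + c.im * d.im := by
    intro c d hc hd
    have e1 := hsq (f c - f d)
    rw [hiso c d hc hd, hsq] at e1
    have e2 := hsq (f c)
    have e3 := hsq (f d)
    have e4 := hsq c
    have e5 := hsq d
    rw [hf c hc] at e2
    rw [hf d hd] at e3
    rw [hc] at e4
    rw [hd] at e5
    simp only [Complex.sub_re, Complex.sub_im] at e1
    nlinarith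
  have hre : ∀ c, ‖c‖ = 1 → (f c).re = c.re := by
    intro c hc
    have := hprod c 1 hc (by simp)
    rw [h1] at this
    simpa using this
  have hI := hre Complex.I (by simp)
  have hI2 := hsq (f Complex.I)
  rw [hf Complex.I (by simp), hI] at hI2
  simp only [Complex.I_re] at hI hI2
  have him : ∀ c, ‖c‖ = 1 → (f c).im * (f Complex.I).im = c.im := by
    intro c hc
    have := hprod c Complex.I hc (by simp)
    simpa [hI] using this
  have hpm : (f Complex.I).im = 1 ∨ (f Complex.I).im = -1 := by
    rw [← mul_self_eq_one_iff]
    linarith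
  rcases hpm with h | h
  · left
    intro c hc
    refine Complex.ext (hre c hc) ?_
    simpa [h] using him c hc
  · right
    intro c hc
    refine Complex.ext (by simpa using hre c hc) ?_
    have := him c hc
    rw [h] at this
    rw [Complex.conj_im]
    linarith

namespace IsSurjectiveSphereIsometry

variable {H : Type u} {H' : Type v}
  [NormedAddCommGroup H] [InnerProductSpace ℂ H] [CompleteSpace H]
  [NormedAddCommGroup H'] [InnerProductSpace ℂ H'] [CompleteSpace H']
  {p : ℝ} {Δ : (H →L[ℂ] H) → (H' →L[ℂ] H')}

theorem map_neg (hΔ : IsSurjectiveSphereIsometry p Δ) (hp : 1 < p) {a : H →L[ℂ] H}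
    (ha : a ∈ schattenSphere p H) : Δ (-a) = -Δ a := by
  have hp0 : 0 < p := by linarith
  have hna := neg_mem_schattenSphere hp0 ha
  have h1 := hΔ.mapsTo ha
  have h2 := neg_mem_schattenSphere hp0 (hΔ.mapsTo hna)
  have h3 : schattenNorm p (Δ a + -Δ (-a)) ^ p = 2 ^ p := by
    rw [← sub_eq_add_neg, hΔ.norm_sub a ha _ hna, sub_neg_eq_add, ← two_smul ℂ a,
      schattenNorm_smul_rpow_of_mem hp0 ha, show ‖(2 : ℂ)‖₊ = 2 from NNReal.eq (by simp)]
    rfl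
  rw [eq_of_schattenNorm_add_eq hp h1.1.1 h2.1.1 (schattenNorm_rpow_of_mem h1)
    (schattenNorm_rpow_of_mem h2) h3, neg_neg]

theorem orth_iff (hΔ : IsSurjectiveSphereIsometry p Δ) (hp : 1 < p) (hp2 : p ≠ 2)
    {a b : H →L[ℂ] H} (ha : a ∈ schattenSphere p H) (hb : b ∈ schattenSphere p H) :
    Orth (Δ a) (Δ b) ↔ Orth a b := by
  have hp0 : 0 < p := by linarith
  have h1 : schattenNorm p (Δ a + Δ b) = schattenNorm p (a + b) := by
    have := hΔ.norm_sub a ha (-b) (neg_mem_schattenSphere hp0 hb)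
    rwa [hΔ.map_neg hp hb, sub_neg_eq_add, sub_neg_eq_add] at this
  rw [orth_iff_of_mem hp0 hp2 ha hb, orth_iff_of_mem hp0 hp2 (hΔ.mapsTo ha) (hΔ.mapsTo hb),
    hΔ.norm_sub a ha b hb, h1]

theorem orth_imp_iff (hΔ : IsSurjectiveSphereIsometry p Δ) (hp : 1 < p) (hp2 : p ≠ 2)
    {a b : H →L[ℂ] H} (ha : a ∈ schattenSphere p H) (hb : b ∈ schattenSphere p H) :
    (∀ c ∈ schattenSphere p H', Orth (Δ a) c → Orth (Δ b) c) ↔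
      ∀ c ∈ schattenSphere p H, Orth a c → Orth b c := by
  constructor
  · intro h c hc hac
    rw [← hΔ.orth_iff hp hp2 hb hc]
    exact h _ (hΔ.mapsTo hc) ((hΔ.orth_iff hp hp2 ha hc).2 hac)
  · intro h c hc hac
    obtain ⟨d, hd, rfl⟩ := hΔ.surjOn hc
    rw [hΔ.orth_iff hp hp2 hb hd]
    exact h d hd ((hΔ.orth_iff hp hp2 ha hd).1 hac)

theorem mem_minimalPartialIsometries_iff (hΔ : IsSurjectiveSphereIsometry p Δ) (hp : 1 < p)
    (hp2 : p ≠ 2) {a : H →L[ℂ] H} (ha : a ∈ schattenSphere p H) :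
    Δ a ∈ minimalPartialIsometries H' ↔ a ∈ minimalPartialIsometries H := by
  have hp0 : 0 < p := by linarith
  rw [mem_minimalPartialIsometries_iff_orth hp0 ha,
    mem_minimalPartialIsometries_iff_orth hp0 (hΔ.mapsTo ha)]
  constructor
  · intro h b hb hab
    rw [← hΔ.orth_imp_iff hp hp2 hb ha]
    exact h _ (hΔ.mapsTo hb) ((hΔ.orth_imp_iff hp hp2 ha hb).2 hab)
  · intro h b hb hab
    obtain ⟨d, hd, rfl⟩ := hΔ.surjOn hb
    rw [hΔ.orth_imp_iff hp hp2 hd ha]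
    exact h d hd ((hΔ.orth_imp_iff hp hp2 ha hd).1 hab)

theorem image_minimalPartialIsometries (hΔ : IsSurjectiveSphereIsometry p Δ) (hp : 1 < p)
    (hp2 : p ≠ 2) : Δ '' minimalPartialIsometries H = minimalPartialIsometries H' := by
  have hp0 : 0 < p := by linarith
  apply Set.Subset.antisymm
  · rintro _ ⟨e, he, rfl⟩
    exact (hΔ.mem_minimalPartialIsometries_iff hp hp2 (minimalPartialIsometries_subset hp0 he)).2 he
  · intro e he
    obtain ⟨a, ha, rfl⟩ := hΔ.surjOn (minimalPartialIsometries_subset hp0 he)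
    exact ⟨a, (hΔ.mem_minimalPartialIsometries_iff hp hp2 ha).1 he, rfl⟩

theorem map_smul (hΔ : IsSurjectiveSphereIsometry p Δ) (hp : 1 < p) (hp2 : p ≠ 2)
    {e : H →L[ℂ] H} (he : e ∈ minimalPartialIsometries H) {c : ℂ} (hc : ‖c‖ = 1) :
    ∃ z : ℂ, ‖z‖ = 1 ∧ Δ (c • e) = z • Δ e := by
  have hp0 : 0 < p := by linarith
  have heS := minimalPartialIsometries_subset hp0 he
  have hceS := smul_mem_schattenSphere hp0 heS hc
  refine eq_smul_of_orth_imp hp0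
    ((hΔ.mem_minimalPartialIsometries_iff hp hp2 heS).2 he) (hΔ.mapsTo hceS) ?_
  rw [hΔ.orth_imp_iff hp hp2 heS hceS]
  intro d _ hd
  exact (orth_smul_left_iff (fun h0 => by simp [h0] at hc)).2 hd

theorem map_smul_or (hΔ : IsSurjectiveSphereIsometry p Δ) (hp : 1 < p) (hp2 : p ≠ 2)
    {e : H →L[ℂ] H} (he : e ∈ minimalPartialIsometries H) :
    (∀ c : ℂ, ‖c‖ = 1 → Δ (c • e) = c • Δ e) ∨
      (∀ c : ℂ, ‖c‖ = 1 → Δ (c • e) = (starRingEnd ℂ c) • Δ e) := by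
  have hp0 : 0 < p := by linarith
  have heS := minimalPartialIsometries_subset hp0 he
  have hΔe := hΔ.mapsTo heS
  choose! f hf1 hf using fun (c : ℂ) (hc : ‖c‖ = 1) => hΔ.map_smul hp hp2 he hc
  have h1 : f 1 = 1 := by
    have := hf 1 (by simp)
    refine smul_left_injective ℂ (ne_zero_of_mem hp0 hΔe) (this.symm.trans ?_)
    simp only [one_smul]
  have hiso : ∀ c d, ‖c‖ = 1 → ‖d‖ = 1 → ‖f c - f d‖ = ‖c - d‖ := by
    intro c d hc hd
    have h2 := hΔ.norm_sub _ (smul_mem_schattenSphere hp0 heS hc) _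
      (smul_mem_schattenSphere hp0 heS hd)
    rw [hf c hc, hf d hd, ← sub_smul, ← sub_smul] at h2
    have h3 := congrArg (· ^ p) h2
    simp only [schattenNorm_smul_rpow_of_mem hp0 hΔe, schattenNorm_smul_rpow_of_mem hp0 heS] at h3
    exact congrArg NNReal.toReal (ENNReal.coe_inj.1 (ENNReal.rpow_left_injective hp0.ne' h3))
  rcases circle_isometry h1 hf1 hiso with h | h
  · exact Or.inl fun c hc => by rw [hf c hc, h c hc]
  · exact Or.inr fun c hc => by rw [hf c hc, h c hc]

theorem eq_smul_of_forall_smul (hΔ : IsSurjectiveSphereIsometry p Δ) (hp : 1 < p) (hp2 : p ≠ 2)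
    {e : H →L[ℂ] H} (he : e ∈ minimalPartialIsometries H) {μ : ℂ} (hμ : ‖μ‖ = 1) (hμ1 : μ ≠ 1)
    (hμ2 : μ ≠ -1) :
    (Δ (μ • e) = μ • Δ e → ∀ c : ℂ, ‖c‖ = 1 → Δ (c • e) = c • Δ e) ∧
      (Δ (μ • e) = (starRingEnd ℂ μ) • Δ e →
        ∀ c : ℂ, ‖c‖ = 1 → Δ (c • e) = (starRingEnd ℂ c) • Δ e) := by
  have hp0 : 0 < p := by linarith
  have hne := ne_zero_of_mem hp0 (hΔ.mapsTo (minimalPartialIsometries_subset hp0 he))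
  have hconj : μ • Δ e ≠ (starRingEnd ℂ μ) • Δ e := by
    intro h
    have h1 := (smul_left_injective ℂ hne h).symm
    obtain ⟨r, rfl⟩ := Complex.conj_eq_iff_real.1 h1
    rw [Complex.norm_real, Real.norm_eq_abs] at hμ
    rcases abs_eq (zero_le_one' ℝ) |>.1 hμ with h2 | h2
    · exact hμ1 (by simp [h2])
    · exact hμ2 (by simp [h2])
  rcases hΔ.map_smul_or hp hp2 he with h | h
  · exact ⟨fun _ => h, fun h' => absurd ((h μ hμ).symm.trans h') hconj⟩
  · exact ⟨fun h' => absurd (h'.symm.trans (h μ hμ)) hconj, fun _ => h⟩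

theorem eq_smul_of_orth_basis (hΔ : IsSurjectiveSphereIsometry p Δ) (hp : 1 < p) (hp2 : p ≠ 2)
    {J : Type*} (η ξ : HilbertBasis J ℂ H) {x : H' →L[ℂ] H'}
    (hx : x ∈ minimalPartialIsometries H') (j : J)
    (h : ∀ k, k ≠ j → Orth (Δ (rankOne ℂ (η k) (ξ k))) x) :
    ∃ z : ℂ, x = z • Δ (rankOne ℂ (η j) (ξ j)) := by
  have hp0 : 0 < p := by linarith
  have hmem : ∀ k, rankOne ℂ (η k) (ξ k) ∈ minimalPartialIsometries H := fun k =>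
    Schatten.mem_minimalPartialIsometries_iff.2
      ⟨_, _, η.orthonormal.1 k, ξ.orthonormal.1 k, rfl⟩
  have hS := fun k => minimalPartialIsometries_subset hp0 (hmem k)
  obtain ⟨y, hy, rfl⟩ := hΔ.surjOn (minimalPartialIsometries_subset hp0 hx)
  have hz : ∀ k, k ≠ j → y (ξ k) = 0 ∧ adjoint y (η k) = 0 := fun k hk =>
    (orth_rankOne_iff (η.orthonormal.1 k) (ξ.orthonormal.1 k)).1
      ((hΔ.orth_iff hp hp2 (hS k) hy).1 (h k hk))
  have key : ∀ (b : HilbertBasis J ℂ H) (T : H →L[ℂ] H), (∀ k, k ≠ j → T (b k) = 0) →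
      ∀ w, inner ℂ (b j) w = 0 → T w = 0 := by
    intro b T hT w hw
    have h1 := hasSum_apply T b w
    have h2 : ∀ k, inner ℂ (b k) w • T (b k) = 0 := by
      intro k
      by_cases hk : k = j
      · rw [hk, hw, zero_smul]
      · rw [hT k hk, smul_zero]
    simp only [h2] at h1
    exact h1.unique hasSum_zero
  have h3 := eq_smul_rankOne (η.orthonormal.1 j) (ξ.orthonormal.1 j)
    (key ξ y fun k hk => (hz k hk).1) (key η (adjoint y) fun k hk => (hz k hk).2)
  have h4 := norm_eq_one_of_smul_mem hp0 (hS j) (h3 ▸ hy)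
  obtain ⟨z, -, hz'⟩ := hΔ.map_smul hp hp2 (hmem j) h4
  exact ⟨z, by rw [h3, hz']⟩

theorem nonempty_of_nonzero (hΔ : IsSurjectiveSphereIsometry p Δ) (hp : 1 < p)
    {J : Type*} (ξ : HilbertBasis J ℂ H) {ζ : H'} (hζ : ‖ζ‖ = 1) : Nonempty J := by
  have hp0 : 0 < p := by linarith
  obtain ⟨y, hy, -⟩ := hΔ.surjOn (rankOne_mem_schattenSphere hp0 hζ hζ)
  by_contra hJ
  rw [not_nonempty_iff] at hJ
  refine ne_zero_of_mem hp0 hy (ContinuousLinearMap.ext fun x => ?_)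
  exact (hasSum_apply y ξ x).unique hasSum_empty

theorem exists_hilbertBasis (hΔ : IsSurjectiveSphereIsometry p Δ) (hp : 1 < p) (hp2 : p ≠ 2)
    {J : Type*} (η ξ : HilbertBasis J ℂ H) :
    ∃ η' ξ' : HilbertBasis J ℂ H', ∀ j : J,
      Δ (rankOne ℂ (η j) (ξ j)) = rankOne ℂ (η' j) (ξ' j) := by
  have hp0 : 0 < p := by linarith
  have hmem : ∀ k, rankOne ℂ (η k) (ξ k) ∈ minimalPartialIsometries H := fun k =>
    Schatten.mem_minimalPartialIsometries_iff.2
      ⟨_, _, η.orthonormal.1 k, ξ.orthonormal.1 k, rfl⟩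
  have hS := fun k => minimalPartialIsometries_subset hp0 (hmem k)
  choose η' ξ' hη' hξ' hΔe using fun k => Schatten.mem_minimalPartialIsometries_iff.1
    ((hΔ.mem_minimalPartialIsometries_iff hp hp2 (hS k)).2 (hmem k))
  have horth : ∀ j k, j ≠ k → inner ℂ (η' j) (η' k) = 0 ∧ inner ℂ (ξ' j) (ξ' k) = 0 := by
    intro j k hjk
    have h1 : Orth (rankOne ℂ (η j) (ξ j)) (rankOne ℂ (η k) (ξ k)) := by
      refine (orth_rankOne_iff (η.orthonormal.1 j) (ξ.orthonormal.1 j)).2 ⟨?_, ?_⟩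
      · rw [rankOne_apply, ξ.orthonormal.2 hjk.symm, zero_smul]
      · rw [adjoint_rankOne, rankOne_apply, η.orthonormal.2 hjk.symm, zero_smul]
    rw [← hΔ.orth_iff hp hp2 (hS j) (hS k), hΔe, hΔe, orth_rankOne_iff (hη' j) (hξ' j),
      adjoint_rankOne, rankOne_apply, rankOne_apply, smul_eq_zero, smul_eq_zero] at h1
    have h2 : η' k ≠ 0 := fun h => by simpa [h] using hη' k
    have h3 : ξ' k ≠ 0 := fun h => by simpa [h] using hξ' k
    exact ⟨inner_eq_zero_symm.1 (h1.2.resolve_right h3),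
      inner_eq_zero_symm.1 (h1.1.resolve_right h2)⟩
  have hoη : Orthonormal ℂ η' := ⟨hη', fun j k hjk => (horth j k hjk).1⟩
  have hoξ : Orthonormal ℂ ξ' := ⟨hξ', fun j k hjk => (horth j k hjk).2⟩
  have hnorm : ∀ x : H', x ≠ 0 → ‖((‖x‖⁻¹ : ℝ) : ℂ) • x‖ = 1 := fun x hx => by
    simp [norm_smul, norm_ne_zero_iff.2 hx]
  have hspan : ∀ f : J → H', (∀ ζ : H', ‖ζ‖ = 1 → (∀ j, inner ℂ (f j) ζ = 0) → False) →
      (Submodule.span ℂ (Set.range f))ᗮ = ⊥ := by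
    intro f hf
    rw [eq_bot_iff]
    intro x hx
    by_contra hx0
    refine hf _ (hnorm x hx0) fun j => ?_
    rw [inner_smul_right, (Submodule.mem_orthogonal _ _).1 hx _ (Submodule.subset_span ⟨j, rfl⟩),
      mul_zero]
  have hη : (Submodule.span ℂ (Set.range η'))ᗮ = ⊥ := by
    refine hspan _ fun ζ hζ hz => ?_
    obtain ⟨j⟩ := hΔ.nonempty_of_nonzero hp ξ hζ
    obtain ⟨z, h⟩ := hΔ.eq_smul_of_orth_basis hp hp2 η ξ
      (Schatten.mem_minimalPartialIsometries_iff.2 ⟨ζ, ξ' j, hζ, hξ' j, rfl⟩) j fun k hk => by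
        rw [hΔe, orth_rankOne_iff (hη' k) (hξ' k), adjoint_rankOne, rankOne_apply, rankOne_apply,
          (horth j k hk.symm).2, inner_eq_zero_symm.1 (hz k), zero_smul, zero_smul]
        exact ⟨rfl, rfl⟩
    rw [hΔe] at h
    have h1 := congrArg (fun T : H' →L[ℂ] H' => inner ℂ ζ (T (ξ' j))) h
    simp [inner_self_eq_norm_sq_to_K, hζ, hξ', inner_eq_zero_symm.1 (hz j)] at h1
  have hξ : (Submodule.span ℂ (Set.range ξ'))ᗮ = ⊥ := by
    refine hspan _ fun ζ hζ hz => ?_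
    obtain ⟨j⟩ := hΔ.nonempty_of_nonzero hp ξ hζ
    obtain ⟨z, h⟩ := hΔ.eq_smul_of_orth_basis hp hp2 η ξ
      (Schatten.mem_minimalPartialIsometries_iff.2 ⟨η' j, ζ, hη' j, hζ, rfl⟩) j fun k hk => by
        rw [hΔe, orth_rankOne_iff (hη' k) (hξ' k), adjoint_rankOne, rankOne_apply, rankOne_apply,
          (horth j k hk.symm).1, inner_eq_zero_symm.1 (hz k), zero_smul, zero_smul]
        exact ⟨rfl, rfl⟩
    rw [hΔe] at h
    have h1 := congrArg (fun T : H' →L[ℂ] H' => inner ℂ (η' j) (T ζ)) h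
    simp [inner_self_eq_norm_sq_to_K, hζ, hη', hz j] at h1
  refine ⟨HilbertBasis.mkOfOrthogonalEqBot hoη hη, HilbertBasis.mkOfOrthogonalEqBot hoξ hξ,
    fun j => ?_⟩
  rw [HilbertBasis.coe_mkOfOrthogonalEqBot, HilbertBasis.coe_mkOfOrthogonalEqBot]
  exact hΔe j

end IsSurjectiveSphereIsometry

end Schatten

end

theorem propositionp
    {H H' : Type*}
    [NormedAddCommGroup H] [InnerProductSpace ℂ H] [CompleteSpace H]
    [NormedAddCommGroup H'] [InnerProductSpace ℂ H'] [CompleteSpace H']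
    (p : ℝ) (hp : 1 < p) (hp2 : p ≠ 2)
    (Δ : (H →L[ℂ] H) → (H' →L[ℂ] H'))
    (hΔ : Schatten.IsSurjectiveSphereIsometry p Δ) :
    -- (a)
    (Schatten.minimalPartialIsometries H ⊆ Schatten.schattenSphere p H ∧
      Δ '' Schatten.minimalPartialIsometries H = Schatten.minimalPartialIsometries H') ∧
    -- (b)
    (∀ e ∈ Schatten.minimalPartialIsometries H,
      (∀ c : ℂ, ‖c‖ = 1 → Δ (c • e) = c • Δ e) ∨
      (∀ c : ℂ, ‖c‖ = 1 → Δ (c • e) = (starRingEnd ℂ c) • Δ e)) ∧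
    -- (c)
    (∀ e ∈ Schatten.minimalPartialIsometries H, ∀ μ : ℂ, ‖μ‖ = 1 → μ ≠ 1 → μ ≠ -1 →
      (Δ (μ • e) = μ • Δ e → ∀ c : ℂ, ‖c‖ = 1 → Δ (c • e) = c • Δ e) ∧
      (Δ (μ • e) = (starRingEnd ℂ μ) • Δ e →
        ∀ c : ℂ, ‖c‖ = 1 → Δ (c • e) = (starRingEnd ℂ c) • Δ e)) ∧
    -- (d)
    (∀ (J : Type*) (η ξ : HilbertBasis J ℂ H),
      ∃ η' ξ' : HilbertBasis J ℂ H', ∀ j : J,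
        Δ (InnerProductSpace.rankOne ℂ (η j) (ξ j)) =
          InnerProductSpace.rankOne ℂ (η' j) (ξ' j)) := by
  have hp0 : 0 < p := by linarith
  exact ⟨⟨Schatten.minimalPartialIsometries_subset hp0, hΔ.image_minimalPartialIsometries hp hp2⟩,
    fun _ he => hΔ.map_smul_or hp hp2 he,
    fun _ he _ hμ hμ1 hμ2 => hΔ.eq_smul_of_forall_smul hp hp2 he hμ hμ1 hμ2,
    fun _ η ξ => hΔ.exists_hilbertBasis hp hp2 η ξ⟩
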